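/- Let $d\in\mathbb N$, $0<s<1$, $\Delta E>0$, $A<\infty$ and $\mu>0$. Then there are $\widetilde A<\infty$ and $\tilde\mu>0$, depending only on these data, such that the following holds. Let $H_\omega=-\Delta+V_\omega$ be a random Schrödinger operator on $\ell^2(\mathbb Z^d)$, where $(\Delta\psi)(x)=\sum_{|y-x|=1}(\psi(y)-\psi(x))$ is the discrete Laplacian and $V_\omega$ acts by multiplication by a random potential whose site values $V_\omega(x)$, $x\in\mathbb Z^d$, are independent identically distributed real random variables with a common distribution that has a bounded density with compact support. For non-real $z$ let $G_\omega(x,y;z)=\langle x|(H_\omega-z)^{-1}|y\rangle$, and let $$\mathbb E\big(|G_\omega(x,y;\xi\pm i0)|^s\big):=\limsup_{\eta\downarrow0}\,\mathbb E\big(|G_\omega(x,y;\xi\pm i\eta)|^s\big)$$ (which is the limit whenever the limit exists). Let $E\in\mathbb R$ and suppose that for all $\xi\in[E-\Delta E,E+\Delta E]$ and all $x,y\in\mathbb Z^d$ $$\mathbb E\big(|G_\omega(x,y;\xi+i0)|^s\big)\le A\,e^{-\mu|x-y|},$$ where $|x-y|$ is the Euclidean distance. Then for all real $\eta\ne0$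 and all $x,y\in\mathbb Z^d$ $$\mathbb E\big(|G_\omega(x,y;E+i\eta)|^s\big)\le\widetilde A\,e^{-\tilde\mu|x-y|},$$ and at $\eta=0$ the same bound holds for both boundary values, $\mathbb E(|G_\omega(x,y;E+i0)|^s)$ and $\mathbb E(|G_\omega(x,y;E-i0)|^s)$. -/

import Mathlib

open MeasureTheory ProbabilityTheory Filter Topology
open scoped ENNReal NNReal

noncomputable section

namespace RandomSchrodinger

/-- The lattice `ℤ^d`. -/
abbrev Site (d : ℕ) : Type := Fin d → ℤ

/-- The Hilbert space `ℓ²(ℤ^d)` of square summable complex functions on `ℤ^d`. -/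
abbrev L2 (d : ℕ) : Type := lp (fun _ : Site d => ℂ) 2

/-- The Euclidean distance `|x - y|` of two lattice points. -/
def latticeDist {d : ℕ} (x y : Site d) : ℝ :=
  Real.sqrt (∑ i, ((x i : ℝ) - (y i : ℝ)) ^ 2)

theorem memlp_shift {d : ℕ} (a : Site d) (ψ : L2 d) :
    Memℓp (fun x : Site d => (ψ : Site d → ℂ) (x + a)) 2 := by
  have h := (lp.memℓp ψ).summable (by norm_num)
  refine (memℓp_gen_iff (by norm_num)).2 ?_
  exact (Equiv.addRight a).summable_iff.2 h

/-- The translation `(T_a ψ)(x) = ψ (x + a)` on `ℓ²(ℤ^d)`. -/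
def shift {d : ℕ} (a : Site d) : L2 d →L[ℂ] L2 d :=
  LinearMap.mkContinuous
    { toFun := fun ψ => ⟨fun x => (ψ : Site d → ℂ) (x + a), memlp_shift a ψ⟩
      map_add' := fun _ _ => rfl
      map_smul' := fun _ _ => rfl } 1 (by
    intro ψ
    rw [one_mul]
    refine lp.norm_le_of_tsum_le (by norm_num) (norm_nonneg ψ) ?_
    rw [lp.norm_rpow_eq_tsum (by norm_num) ψ]
    exact ((Equiv.addRight a).tsum_eq
      (fun x => ‖(ψ : Site d → ℂ) x‖ ^ (2 : ℝ≥0∞).toReal)).le)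

/-- The discrete Laplacian
`(Δψ)(x) = ∑_{|y - x| = 1} (ψ(y) - ψ(x)) = ∑_i (ψ(x + e_i) + ψ(x - e_i) - 2 ψ(x))`. -/
def laplacian (d : ℕ) : L2 d →L[ℂ] L2 d :=
  ∑ i : Fin d, (shift (Pi.single i 1) + shift (-Pi.single i 1)
    - (2 : ℂ) • ContinuousLinearMap.id ℂ (L2 d))

theorem norm_mul_le {d : ℕ} {v : Site d → ℝ} {C : ℝ} (hv : ∀ x, |v x| ≤ C)
    (ψ : L2 d) (x : Site d) :
    ‖(v x : ℂ) * (ψ : Site d → ℂ) x‖ ≤ ‖((C : ℂ) • ψ : L2 d) x‖ := by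
  have hC : 0 ≤ C := (abs_nonneg _).trans (hv x)
  rw [lp.coeFn_smul, Pi.smul_apply, smul_eq_mul, norm_mul, norm_mul, Complex.norm_real,
    Complex.norm_real, Real.norm_eq_abs, Real.norm_eq_abs, abs_of_nonneg hC]
  exact mul_le_mul_of_nonneg_right (hv x) (norm_nonneg _)

theorem memlp_mul {d : ℕ} {v : Site d → ℝ} (hv : ∃ C, ∀ x, |v x| ≤ C) (ψ : L2 d) :
    Memℓp (fun x : Site d => (v x : ℂ) * (ψ : Site d → ℂ) x) 2 := by
  obtain ⟨C, hC⟩ := hv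
  exact (lp.memℓp ((C : ℂ) • ψ)).mono' (norm_mul_le hC ψ)

open Classical in
/-- The operator of multiplication by a bounded real potential `v` on `ℓ²(ℤ^d)`.
(Potentials with values in a bounded set are the only ones that matter here; the value `0` for an
unbounded `v` is a convention, used on a set of configurations of probability zero.) -/
def potentialOp {d : ℕ} (v : Site d → ℝ) : L2 d →L[ℂ] L2 d :=
  if hv : ∃ C, ∀ x, |v x| ≤ C then
    LinearMap.mkContinuousOfExistsBound
      { toFun := fun ψ => ⟨fun x => (v x : ℂ) * (ψ : Site d → ℂ) x, memlp_mul hv ψ⟩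
        map_add' := fun φ ψ => by
          ext x
          exact mul_add _ _ _
        map_smul' := fun c ψ => by
          ext x
          exact mul_left_comm _ _ _ } (by
      obtain ⟨C, hC⟩ := hv
      refine ⟨‖(C : ℂ)‖, fun ψ => ?_⟩
      rw [← norm_smul]
      exact lp.norm_mono (by norm_num) (norm_mul_le hC ψ))
  else 0

/-- The discrete Schrödinger operator `H = -Δ + v` on `ℓ²(ℤ^d)`. -/
def hamiltonian {d : ℕ} (v : Site d → ℝ) : L2 d →L[ℂ] L2 d :=
  -laplacian d + potentialOp v

/-- The unit vector `|x⟩` of `ℓ²(ℤ^d)`. -/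
def delta {d : ℕ} (x : Site d) : L2 d := lp.single 2 x (1 : ℂ)

/-- The Green function `G(x, y; z) = ⟨x| (H - z)⁻¹ |y⟩`. It is used for non-real `z` only, where
`H - z` is invertible because `H` is self-adjoint. -/
def green {d : ℕ} (v : Site d → ℝ) (x y : Site d) (z : ℂ) : ℂ :=
  inner ℂ (delta x)
    (Ring.inverse (hamiltonian v - z • ContinuousLinearMap.id ℂ (L2 d)) (delta y))

/-- `V` is a random potential on `ℤ^d` with a regular distribution: the site values `V x` are
independent identically distributed real random variables, whose common distribution has a
bounded density with compact support. -/
structure IsRegularPotential {d : ℕ} {Ω : Type*} [MeasurableSpace Ω] (P : Measure Ω)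
    (V : Site d → Ω → ℝ) : Prop where
  measurable : ∀ x, Measurable (V x)
  indep : iIndepFun V P
  density : ∃ ρ : ℝ → ℝ≥0, Measurable ρ ∧ BddAbove (Set.range ρ) ∧ HasCompactSupport ρ ∧
    ∀ x, P.map (V x) = volume.withDensity (fun t => (ρ t : ℝ≥0∞))

/-- The fractional moment `𝔼(|⟨x| (H_ω - E - iη)⁻¹ |y⟩|^s)`, for `η ≠ 0`. -/
def greenMoment {d : ℕ} {Ω : Type*} [MeasurableSpace Ω] (P : Measure Ω)
    (V : Site d → Ω → ℝ) (s : ℝ) (x y : Site d) (E η : ℝ) : ℝ≥0∞ :=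
  ∫⁻ ω, ENNReal.ofReal
    (‖green (fun u => V u ω) x y ((E : ℂ) + (η : ℂ) * Complex.I)‖ ^ s) ∂P

/-- The boundary value `𝔼(|⟨x| (H_ω - E - i0)⁻¹ |y⟩|^s) = lim_{η ↘ 0} 𝔼(|G(x, y; E + iη)|^s)`.
It is written as an upper limit in `[0, ∞]`, which is the limit whenever the limit exists. -/
def greenMomentPlus {d : ℕ} {Ω : Type*} [MeasurableSpace Ω] (P : Measure Ω)
    (V : Site d → Ω → ℝ) (s : ℝ) (x y : Site d) (E : ℝ) : ℝ≥0∞ :=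
  limsup (fun η : ℝ => greenMoment P V s x y E η) (𝓝[>] 0)

/-- The boundary value `lim_{η ↗ 0} 𝔼(|G(x, y; E + iη)|^s)` from below the real axis, again
written as an upper limit. -/
def greenMomentMinus {d : ℕ} {Ω : Type*} [MeasurableSpace Ω] (P : Measure Ω)
    (V : Site d → Ω → ℝ) (s : ℝ) (x y : Site d) (E : ℝ) : ℝ≥0∞ :=
  limsup (fun η : ℝ => greenMoment P V s x y E η) (𝓝[<] 0)

end RandomSchrodinger

end

/-! For a fixed realisation and `ε > 0`, the function `G(E + z + iε)` is analytic for `Im z > -ε`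
and bounded on the closed upper half plane, and `|G|^s` is subharmonic. Its value at `z = iη` is
therefore at most its average over the real line against the Poisson kernel seen from `iη`
(`norm_rpow_le_lintegral_poisson`). On `|ξ| < ρ`, with `ρ = ΔE`, the hypothesis supplies exponential
decay of the averaged boundary values as `ε → 0`. For larger `|ξ|` there is only an a priori bound:
diagonal matrix elements of the resolvent map the upper half plane into itself, so Kolmogorov's
inequality controls their `s`-th powers uniformly in `ε`, and polarization extends this to all
matrix elements (`lintegral_poisson_resolventOp_le`).

The non-decaying far part is beaten by an analytic weight, as in the two-constants theorem.
Multiplying `G` by `exp((2a/s) Φ)`, where `Re Φ` is at most `1/2` on the half plane, at most `0` on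
the line outside `(-ρ, ρ)` and at least `1/6` at `iη` for `0 < η ≤ ρ/2`, gives `e^{a/3} 𝔼|G|^s ≤ e^a
· (near part) + const` (`norm_rpow_mul_exp_le_lintegral_poisson`, `greenMoment_mul_exp_le`). With `a
= μ|x - y|` the near term is bounded, and decay at rate `μ/3` results.

The hypothesis concerns an upper limit at each energy separately, so passing to `ε → 0` under the
energy integral needs a reverse Fatou lemma. Uniform integrability comes from the a priori bound for
a larger exponent `s' < 1`. For `η ≥ ΔE/2` the Combes–Thomas estimate `norm_green_le_exp` suffices,
and `η < 0` reduces to `η > 0` by taking adjoints. Bounds uniform in `η ≠ 0` pass to both boundary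
values. -/

noncomputable section

namespace RandomSchrodinger

/-! ### Fractional powers of analytic functions on a disc -/

open Metric Real in
/-- Sub-mean value property of `‖f‖ ^ s` for analytic `f`. -/
theorem norm_rpow_le_circleAverage {f : ℂ → ℂ} {c : ℂ} {R s : ℝ} (hR : 0 < R) (hs : 0 < s)
    (hf : AnalyticOnNhd ℂ f (closedBall c R)) :
    ‖f c‖ ^ s ≤ circleAverage (fun z => ‖f z‖ ^ s) c R := by
  by_cases h0 : f c = 0
  · rw [h0, norm_zero, zero_rpow hs.ne']
    exact circleAverage_nonneg_of_nonneg fun z _ => by positivity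
  have hRa : |R| = R := abs_of_pos hR
  have hf' : AnalyticOnNhd ℂ f (closedBall c |R|) := by rwa [hRa]
  set a := ‖f c‖ with ha
  have ha0 : 0 < a := norm_pos_iff.2 h0
  have hcod : ∀ᶠ z in codiscreteWithin (sphere c |R|), f z ≠ 0 := by
    have h1 := hf'.preimage_zero_mem_codiscreteWithin (x := c) h0 (by simp)
      ⟨⟨c, by simp⟩, (convex_closedBall c |R|).isPreconnected⟩
    exact codiscreteWithin_mono sphere_subset_closedBall h1
  -- At zeros of `f` the convention `log 0 = 0` would break the pointwise bound `hpt`. The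
  -- replacement value `log a - 1/s` makes the left side of `hpt` vanish there, and zeros do not
  -- affect the average.
  let k : ℂ → ℝ := fun z => if f z = 0 then log a - 1 / s else log ‖f z‖
  have hk : (fun z => log ‖f z‖) =ᶠ[codiscreteWithin (sphere c |R|)] k := by
    filter_upwards [hcod] with z hz
    simp [k, hz]
  have hlogint : CircleIntegrable (fun z => log ‖f z‖) c R :=
    (hf.mono sphere_subset_closedBall).meromorphicOn.circleIntegrable_log_norm_of_nonneg hR.le
  have hkint : CircleIntegrable k c R := hlogint.congr_codiscreteWithin hk
  have havg : log a ≤ circleAverage k c R := by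
    rw [← circleAverage_congr_codiscreteWithin hk hR.ne',
      hf'.circleAverage_log_norm hR.ne' h0]
    -- Jensen's formula: each zero in the disc contributes a nonnegative term, so `log ‖f‖` has the
    -- sub-mean value property.
    have : 0 ≤ ∑ᶠ u, MeromorphicOn.divisor f (closedBall c |R|) u * log (R * ‖c - u‖⁻¹) := by
      refine finsum_nonneg fun u => ?_
      by_cases hu : u ∈ closedBall c |R|
      · refine mul_nonneg ?_ ?_
        · have := MeromorphicOn.AnalyticOnNhd.divisor_nonneg hf' u
          exact_mod_cast this
        · by_cases hcu : c = u
          · simp [hcu]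
          · refine log_nonneg ?_
            have h1 : 0 < ‖c - u‖ := norm_pos_iff.2 (sub_ne_zero.2 hcu)
            rw [← div_eq_mul_inv, one_le_div h1]
            rwa [hRa, mem_closedBall', dist_eq_norm] at hu
      · simp [Function.locallyFinsuppWithin.apply_eq_zero_of_notMem _ hu]
    linarith
  have hint : CircleIntegrable (fun z => ‖f z‖ ^ s) c R := by
    refine ContinuousOn.circleIntegrable hR.le ?_
    exact (hf.continuousOn.mono sphere_subset_closedBall).norm.rpow_const fun _ _ => Or.inr hs.le
  -- Tangent line of the convex function `t ↦ exp (s t)` at `t = log a`; this is Jensen's inequality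
  -- made explicit.
  have hpt : ∀ z, a ^ s * (1 + s * (k z - log a)) ≤ ‖f z‖ ^ s := by
    intro z
    by_cases hz : f z = 0
    · simp only [k, hz, if_true, norm_zero, zero_rpow hs.ne']
      field_simp
      simp
    · simp only [k, hz, if_false]
      have hz0 : 0 < ‖f z‖ := norm_pos_iff.2 hz
      have h1 := add_one_le_exp (s * (log ‖f z‖ - log a))
      have h2 : ‖f z‖ ^ s = a ^ s * exp (s * (log ‖f z‖ - log a)) := by
        rw [rpow_def_of_pos hz0, rpow_def_of_pos ha0, ← exp_add]
        congr 1
        ring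
      rw [h2]
      gcongr
      linarith
  have e : (fun z => a ^ s * (1 + s * (k z - log a)))
      = (fun z => (a ^ s * s) • k z) + (fun _ => a ^ s * (1 - s * log a)) := by
    ext z
    simp only [Pi.add_apply, smul_eq_mul]
    ring
  have hfin : circleAverage (fun z => a ^ s * (1 + s * (k z - log a))) c R
      = a ^ s * (1 + s * (circleAverage k c R - log a)) := by
    rw [e, circleAverage_add (by exact hkint.const_mul _) (circleIntegrable_const _ _ _),
      circleAverage_fun_smul, circleAverage_const]
    simp; ring
  calc a ^ s ≤ a ^ s * (1 + s * (circleAverage k c R - log a)) := by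
        have : 0 ≤ s * (circleAverage k c R - log a) := mul_nonneg hs.le (by linarith)
        have h3 : 0 < a ^ s := by positivity
        nlinarith
    _ ≤ _ := by
        rw [← hfin]
        refine circleAverage_mono ?_ hint fun z _ => hpt z
        rw [e]
        exact CircleIntegrable.add (by exact hkint.const_mul _) (circleIntegrable_const _ _ _)

open Metric Real in
/-- Kolmogorov's inequality for fractional powers of a function with values in the upper half
plane. -/
theorem circleAverage_norm_rpow_le {F : ℂ → ℂ} {c : ℂ} {R s : ℝ} (hR : 0 < R) (hs : 0 < s)
    (hs1 : s < 1) (hF : AnalyticOnNhd ℂ F (closedBall c R))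
    (him : ∀ z ∈ closedBall c R, 0 < (F z).im) :
    circleAverage (fun z => ‖F z‖ ^ s) c R ≤ ‖F c‖ ^ s / cos (π * s / 2) := by
  have hRa : |R| = R := abs_of_pos hR
  have hcos : 0 < cos (π * s / 2) :=
    cos_pos_of_mem_Ioo ⟨by nlinarith [pi_pos], by nlinarith [pi_pos]⟩
  -- The rotation centres the argument: `arg F - π/2` lies in `[-π/2, π/2]`, so `Re g` lies between
  -- `cos (π s / 2) ‖F‖ ^ s` and `‖F‖ ^ s`, and `Re g` is harmonic.
  let g : ℂ → ℂ := fun z => Complex.exp (-(π * s / 2 : ℝ) * Complex.I) * F z ^ (s : ℂ)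
  have hg : AnalyticOnNhd ℂ g (closedBall c R) := fun z hz =>
    analyticAt_const.mul ((hF z hz).cpow analyticAt_const (Or.inr (him z hz).ne'))
  have hre : ∀ z ∈ closedBall c R,
      (g z).re = ‖F z‖ ^ s * cos (s * (Complex.arg (F z) - π / 2)) := by
    intro z hz
    have hne : F z ≠ 0 := fun h => by simpa [h] using him z hz
    have e1 : g z = (‖F z‖ ^ s : ℝ) *
        Complex.exp ((s * (Complex.arg (F z) - π / 2) : ℝ) * Complex.I) := by
      simp only [g]
      rw [Complex.cpow_def_of_ne_zero hne, Complex.log, add_mul, Complex.exp_add,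
        rpow_def_of_pos (norm_pos_iff.2 hne)]
      push_cast
      rw [mul_left_comm, ← Complex.exp_add]
      congr 2
      ring
    rw [e1, Complex.re_ofReal_mul, Complex.exp_ofReal_mul_I_re]
  have hmean : circleAverage (fun z => (g z).re) c R = (g c).re :=
    InnerProductSpace.HarmonicOnNhd.circleAverage_eq (f := fun z => (g z).re)
      (fun z hz => (hg z (by rwa [hRa] at hz)).harmonicAt_re)
  rw [le_div_iff₀ hcos]
  have hc : c ∈ closedBall c R := mem_closedBall_self hR.le
  have h1 : (g c).re ≤ ‖F c‖ ^ s := by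
    rw [hre c hc]
    exact mul_le_of_le_one_right (by positivity) (cos_le_one _)
  have h2 : circleAverage (fun z => cos (π * s / 2) • ‖F z‖ ^ s) c R
      ≤ circleAverage (fun z => (g z).re) c R := by
    refine circleAverage_mono ?_ ?_ fun z hz => ?_
    · refine ContinuousOn.circleIntegrable hR.le ?_
      exact ContinuousOn.const_smul ((hF.continuousOn.mono sphere_subset_closedBall).norm.rpow_const
        fun _ _ => Or.inr hs.le) (cos (π * s / 2))
    · refine ContinuousOn.circleIntegrable hR.le ?_
      exact Complex.continuous_re.comp_continuousOn
        (hg.continuousOn.mono sphere_subset_closedBall)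
    · have hz' : z ∈ closedBall c R := by rw [hRa] at hz; exact sphere_subset_closedBall hz
      rw [hre z hz', smul_eq_mul, mul_comm]
      refine mul_le_mul_of_nonneg_left ?_ (by positivity)
      have ha0 : 0 ≤ Complex.arg (F z) := Complex.arg_nonneg_iff.2 (him z hz').le
      have ha1 : Complex.arg (F z) ≤ π := Complex.arg_le_pi _
      rw [← cos_abs (s * _)]
      refine cos_le_cos_of_nonneg_of_le_pi (abs_nonneg _) (by nlinarith [pi_pos]) ?_
      rw [abs_mul, abs_of_pos hs]
      have : |Complex.arg (F z) - π / 2| ≤ π / 2 := abs_le.2 ⟨by linarith, by linarith⟩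
      nlinarith
  rw [circleAverage_fun_smul, smul_eq_mul] at h2
  linarith

/-! ### Transfer from the disc to the half plane -/

/-- The harmonic measure of the upper half plane, seen from `iη`. -/
def poissonMeasure (η : ℝ) : Measure ℝ :=
  volume.withDensity fun ξ => ENNReal.ofReal (η / (Real.pi * (ξ ^ 2 + η ^ 2)))

/-- The Möbius map of the unit disc onto the upper half plane which maps `0` to `iη`. -/
def mobius (η : ℝ) (w : ℂ) : ℂ := η * Complex.I * ((1 - w) / (1 + w))

theorem one_add_ne_zero_of_norm_lt {w : ℂ} (hw : ‖w‖ < 1) : 1 + w ≠ 0 := by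
  intro h
  rw [add_eq_zero_iff_neg_eq] at h
  rw [← h, norm_neg, norm_one] at hw
  exact lt_irrefl _ hw

theorem mobius_im (η : ℝ) (w : ℂ) :
    (mobius η w).im = η * ((1 - ‖w‖ ^ 2) / Complex.normSq (1 + w)) := by
  rw [mobius, mul_assoc, Complex.im_ofReal_mul, Complex.I_mul_im, Complex.div_re,
    ← Complex.normSq_eq_norm_sq, Complex.normSq_apply w]
  congr 1
  simp
  ring

theorem mobius_im_pos {η : ℝ} (hη : 0 < η) {w : ℂ} (hw : ‖w‖ < 1) : 0 < (mobius η w).im := by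
  rw [mobius_im]
  have h1 : 0 < Complex.normSq (1 + w) := Complex.normSq_pos.2 (one_add_ne_zero_of_norm_lt hw)
  have h2 : 0 < 1 - ‖w‖ ^ 2 := by nlinarith [norm_nonneg w]
  positivity

/-- With `u = exp (iθ/2)` one has `(1 - u²)/(1 + u²) = -i tan (θ/2)`. The excluded angles are those
sent to infinity. -/
theorem mobius_circle (η : ℝ) {θ : ℝ} (hθ : Real.cos (θ / 2) ≠ 0) :
    mobius η (circleMap 0 1 θ) = (η * Real.tan (θ / 2) : ℝ) ∧ 1 + circleMap 0 1 θ ≠ 0 := by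
  have hc : circleMap 0 1 θ = Complex.exp ((θ / 2 : ℂ) * Complex.I) ^ 2 := by
    rw [← Complex.exp_nat_mul]; simp [circleMap]; ring_nf
  have h1 : Complex.exp ((θ / 2 : ℂ) * Complex.I) ≠ 0 := Complex.exp_ne_zero _
  set u := Complex.exp ((θ / 2 : ℂ) * Complex.I) with hu
  have hcos : (Real.cos (θ / 2) : ℂ) = (u + u⁻¹) / 2 := by
    rw [hu, ← Complex.exp_neg]; push_cast; rw [Complex.cos]; ring_nf
  have hsin : (Real.sin (θ / 2) : ℂ) = (u⁻¹ - u) * Complex.I / 2 := by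
    rw [hu, ← Complex.exp_neg]; push_cast; rw [Complex.sin]; ring_nf
  have hne : (Real.cos (θ / 2) : ℂ) ≠ 0 := by exact_mod_cast hθ
  have h2 : 1 + u ^ 2 = 2 * u * (Real.cos (θ / 2) : ℂ) := by
    rw [hcos]
    field_simp
    ring
  have h2' : 1 + u ^ 2 ≠ 0 := by
    rw [h2]; exact mul_ne_zero (mul_ne_zero two_ne_zero h1) hne
  refine ⟨?_, by rwa [hc]⟩
  rw [Real.tan_eq_sin_div_cos, hc, mobius]
  push_cast
  rw [← Complex.ofReal_ofNat, ← Complex.ofReal_div, ← Complex.ofReal_sin, ← Complex.ofReal_cos]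
  rw [mul_assoc]
  congr 1
  rw [h2, ← mul_div_assoc]
  rw [div_eq_div_iff (by rw [← h2]; exact h2') hne, hsin]
  field_simp

-- Circles of radius `t < 1` stay inside the half plane and approach its boundary as `t → 1`.
-- Dominated convergence applies because `q` is bounded on the closed half plane and continuous
-- across the real line, the margin `ε` providing the latter.
open Real in
theorem tendsto_circleAverage_mobius {η ε C : ℝ} (hη : 0 < η) (hε : 0 < ε) {q : ℂ → ℝ}
    (hq : ContinuousOn q {z | -ε < z.im}) (hC : ∀ z : ℂ, 0 ≤ z.im → |q z| ≤ C) :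
    Tendsto (fun t : ℝ => circleAverage (fun w => q (mobius η w)) 0 t) (𝓝[<] 1)
      (𝓝 ((2 * π)⁻¹ * ∫ θ in (-π)..π, q ((η * tan (θ / 2) : ℝ)))) := by
  have e : ∀ t : ℝ, circleAverage (fun w => q (mobius η w)) 0 t
      = (2 * π)⁻¹ * ∫ θ in (-π)..π, q (mobius η (circleMap 0 t θ)) := by
    intro t
    rw [circleAverage_eq_integral_add (-π), smul_eq_mul]
    congr 1
    rw [intervalIntegral.integral_comp_add_right (fun θ => q (mobius η (circleMap 0 t θ)))]
    congr 1 <;> ring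
  simp_rw [e]
  refine Tendsto.const_mul _ ?_
  have hev : ∀ᶠ t : ℝ in 𝓝[<] 1, 0 < t ∧ t < 1 := by
    have : Set.Ioo (0 : ℝ) 1 ∈ 𝓝[<] (1 : ℝ) := Ioo_mem_nhdsLT (by norm_num)
    exact this
  have hnorm : ∀ {t θ : ℝ}, 0 < t → t < 1 → ‖circleMap 0 t θ‖ < 1 := by
    intro t θ h0 h1
    rwa [norm_circleMap_zero, abs_of_pos h0]
  refine intervalIntegral.tendsto_integral_filter_of_dominated_convergence (fun _ => C) ?_ ?_
    (by simp) ?_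
  · filter_upwards [hev] with t ht
    refine Continuous.aestronglyMeasurable ?_
    rw [← continuousOn_univ]
    refine hq.comp (t := {z | -ε < z.im}) (s := Set.univ) (f := fun θ => mobius η (circleMap 0 t θ)) ?_ ?_
    · refine continuousOn_const.mul (ContinuousOn.div (by fun_prop) (by fun_prop) ?_)
      exact fun θ _ => one_add_ne_zero_of_norm_lt (hnorm ht.1 ht.2)
    · intro θ _
      have := mobius_im_pos hη (hnorm (θ := θ) ht.1 ht.2)
      simp only [Set.mem_ofPred_eq]
      linarith
  · filter_upwards [hev] with t ht
    refine ae_of_all _ fun θ _ => ?_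
    exact hC _ (mobius_im_pos hη (hnorm (θ := θ) ht.1 ht.2)).le
  · have hae : ∀ᵐ θ : ℝ, θ ≠ π := by simp [ae_iff]
    filter_upwards [hae] with θ hθ hθ'
    rw [Set.uIoc_of_le (by linarith [pi_pos])] at hθ'
    have hcos : cos (θ / 2) ≠ 0 := by
      refine (cos_pos_of_mem_Ioo ⟨by linarith [hθ'.1], ?_⟩).ne'
      have := lt_of_le_of_ne hθ'.2 hθ
      linarith
    obtain ⟨h1, h2⟩ := mobius_circle η hcos
    rw [← h1]
    have hq' : ContinuousAt q (mobius η (circleMap 0 1 θ)) := by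
      refine hq.continuousAt (IsOpen.mem_nhds (isOpen_lt continuous_const Complex.continuous_im) ?_)
      rw [h1, Set.mem_ofPred_eq, Complex.ofReal_im]
      linarith
    have hm : ContinuousAt (fun t : ℝ => mobius η (circleMap 0 t θ)) 1 := by
      unfold mobius
      refine continuousAt_const.mul (ContinuousAt.div ?_ ?_ h2)
      all_goals
        unfold circleMap
        fun_prop
    exact (ContinuousAt.tendsto (f := fun t : ℝ => q (mobius η (circleMap 0 t θ))) (x := 1)
      (ContinuousAt.comp (f := fun t : ℝ => mobius η (circleMap 0 t θ)) hq' hm)).mono_left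
        nhdsWithin_le_nhds

-- Uniform measure on the circle becomes harmonic measure under `ξ = η tan (θ/2)`; the inverse
-- substitution `θ = 2 arctan (ξ/η)` has derivative `2η/(ξ² + η²)`.
open Real in
theorem lintegral_poissonMeasure_eq {η : ℝ} (hη : 0 < η) (g : ℝ → ℝ≥0∞) (hg : Measurable g) :
    ∫⁻ ξ, g ξ ∂(poissonMeasure η)
      = ENNReal.ofReal (2 * π)⁻¹ * ∫⁻ θ in Set.Ioo (-π) π, g (η * tan (θ / 2)) := by
  have him : (fun ξ : ℝ => 2 * arctan (ξ / η)) '' Set.univ = Set.Ioo (-π) π := by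
    ext θ
    simp only [Set.image_univ, Set.mem_range, Set.mem_Ioo]
    constructor
    · rintro ⟨ξ, rfl⟩
      have h1 := neg_pi_div_two_lt_arctan (ξ / η)
      have h2 := arctan_lt_pi_div_two (ξ / η)
      constructor <;> linarith
    · rintro ⟨h1, h2⟩
      refine ⟨η * tan (θ / 2), ?_⟩
      rw [mul_div_cancel_left₀ _ hη.ne', arctan_tan (by linarith) (by linarith)]
      ring
  have hder : ∀ ξ ∈ Set.univ, HasDerivWithinAt (fun ξ : ℝ => 2 * arctan (ξ / η))
      (2 * (1 / (1 + (ξ / η) ^ 2) * (1 / η))) Set.univ ξ := fun ξ _ =>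
    ((((hasDerivAt_id ξ).div_const η).arctan).const_mul 2).hasDerivWithinAt
  have hinj : Set.InjOn (fun ξ : ℝ => 2 * arctan (ξ / η)) Set.univ := by
    intro a _ b _ h
    have := arctan_injective (mul_left_cancel₀ two_ne_zero h)
    field_simp at this
    exact this
  rw [← him, lintegral_image_eq_lintegral_abs_deriv_mul MeasurableSet.univ hder hinj,
    Measure.restrict_univ, ← lintegral_const_mul' _ _ ENNReal.ofReal_ne_top, poissonMeasure,
    lintegral_withDensity_eq_lintegral_mul _ (by fun_prop) hg]
  refine lintegral_congr fun ξ => ?_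
  rw [← mul_assoc, ← ENNReal.ofReal_mul (by positivity), Pi.mul_apply]
  have e1 : η * tan (2 * arctan (ξ / η) / 2) = ξ := by
    rw [mul_div_cancel_left₀ _ two_ne_zero, tan_arctan, mul_div_cancel₀ _ hη.ne']
  rw [e1]
  congr 2
  rw [abs_of_pos (by positivity)]
  field_simp
  ring

theorem isProbabilityMeasure_poissonMeasure {η : ℝ} (hη : 0 < η) :
    IsProbabilityMeasure (poissonMeasure η) := by
  constructor
  have := lintegral_poissonMeasure_eq hη (fun _ => 1) measurable_const
  rw [lintegral_const, one_mul, lintegral_const, one_mul, Measure.restrict_apply MeasurableSet.univ,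
    Set.univ_inter, Real.volume_Ioo, ← ENNReal.ofReal_mul (by positivity)] at this
  rw [this]
  have hpi := Real.pi_pos
  rw [show (2 * Real.pi)⁻¹ * (Real.pi - -Real.pi) = 1 by field_simp; ring, ENNReal.ofReal_one]

theorem continuous_comp_ofReal {ε : ℝ} (hε : 0 < ε) {q : ℂ → ℝ}
    (hq : ContinuousOn q {z | -ε < z.im}) : Continuous fun ξ : ℝ => q ξ := by
  rw [← continuousOn_univ]
  exact hq.comp (by fun_prop) fun ξ _ => by simpa using hε

open Real in
theorem ofReal_integral_tan_eq {η ε C : ℝ} (hη : 0 < η) (hε : 0 < ε) {q : ℂ → ℝ}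
    (hq : ContinuousOn q {z | -ε < z.im}) (hC : ∀ z : ℂ, 0 ≤ z.im → |q z| ≤ C) (h0 : ∀ z, 0 ≤ q z) :
    ENNReal.ofReal ((2 * π)⁻¹ * ∫ θ in (-π)..π, q ((η * tan (θ / 2) : ℝ)))
      = ∫⁻ ξ : ℝ, ENNReal.ofReal (q ξ) ∂(poissonMeasure η) := by
  have hcont := continuous_comp_ofReal hε hq
  rw [lintegral_poissonMeasure_eq hη (fun ξ : ℝ => ENNReal.ofReal (q ξ))
      hcont.measurable.ennreal_ofReal,
    ENNReal.ofReal_mul (by positivity), intervalIntegral.integral_of_le (by linarith [pi_pos]),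
    integral_Ioc_eq_integral_Ioo, ofReal_integral_eq_lintegral_ofReal]
  · refine Integrable.mono' (g := fun _ => C) (by simp) ?_ (ae_of_all _ fun θ => hC _ (Complex.ofReal_im _).ge)
    refine (hcont.measurable.comp ?_).aestronglyMeasurable
    simp_rw [tan_eq_sin_div_cos]
    fun_prop
  · exact ae_of_all _ fun θ => h0 _

theorem analyticOnNhd_comp_mobius {η ε t : ℝ} (hη : 0 < η) (hε : 0 < ε) (ht1 : t < 1)
    {f : ℂ → ℂ} (hf : DifferentiableOn ℂ f {z | -ε < z.im}) :
    AnalyticOnNhd ℂ (fun w => f (mobius η w)) (Metric.closedBall 0 t) := by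
  have hd : DifferentiableOn ℂ (fun w => f (mobius η w)) (Metric.ball 0 1) := by
    refine hf.comp ?_ ?_
    · intro w hw
      have := one_add_ne_zero_of_norm_lt (mem_ball_zero_iff.1 hw)
      unfold mobius
      refine DifferentiableAt.differentiableWithinAt ?_
      fun_prop (disch := assumption)
    · intro w hw
      have := mobius_im_pos hη (mem_ball_zero_iff.1 hw)
      simp only [Set.mem_ofPred_eq]
      linarith
  exact (hd.analyticOnNhd Metric.isOpen_ball).mono (Metric.closedBall_subset_ball ht1)

theorem mobius_zero (η : ℝ) : mobius η 0 = η * Complex.I := by simp [mobius]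

/-- Sub-mean value property of `‖f‖ ^ s` with respect to harmonic measure of the half plane. -/
theorem norm_rpow_le_lintegral_poisson {η ε C s : ℝ} (hη : 0 < η) (hε : 0 < ε) (hs : 0 < s)
    {f : ℂ → ℂ} (hf : DifferentiableOn ℂ f {z | -ε < z.im})
    (hC : ∀ z : ℂ, 0 ≤ z.im → ‖f z‖ ≤ C) :
    ENNReal.ofReal (‖f (η * Complex.I)‖ ^ s)
      ≤ ∫⁻ ξ : ℝ, ENNReal.ofReal (‖f ξ‖ ^ s) ∂(poissonMeasure η) := by
  have hq : ContinuousOn (fun z => ‖f z‖ ^ s) {z | -ε < z.im} :=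
    hf.continuousOn.norm.rpow_const fun _ _ => Or.inr hs.le
  have hqC : ∀ z : ℂ, 0 ≤ z.im → |‖f z‖ ^ s| ≤ C ^ s := fun z hz => by
    rw [abs_of_nonneg (by positivity)]
    exact Real.rpow_le_rpow (norm_nonneg _) (hC z hz) hs.le
  rw [← ofReal_integral_tan_eq hη hε hq hqC fun z => by positivity]
  refine ENNReal.ofReal_le_ofReal (ge_of_tendsto (tendsto_circleAverage_mobius hη hε hq hqC) ?_)
  filter_upwards [show Set.Ioo (0 : ℝ) 1 ∈ 𝓝[<] (1 : ℝ) from Ioo_mem_nhdsLT (by norm_num)] with t ht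
  have := norm_rpow_le_circleAverage ht.1 hs (analyticOnNhd_comp_mobius hη hε ht.2 hf)
  rwa [mobius_zero] at this

/-- Kolmogorov's inequality on a horizontal line. -/
theorem lintegral_poisson_norm_rpow_le {η ε C s : ℝ} (hη : 0 < η) (hε : 0 < ε) (hs : 0 < s)
    (hs1 : s < 1) {f : ℂ → ℂ} (hf : DifferentiableOn ℂ f {z | -ε < z.im})
    (hC : ∀ z : ℂ, 0 ≤ z.im → ‖f z‖ ≤ C) (him : ∀ z : ℂ, 0 ≤ z.im → 0 ≤ (f z).im) :
    ∫⁻ ξ : ℝ, ENNReal.ofReal (‖f ξ‖ ^ s) ∂(poissonMeasure η)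
      ≤ ENNReal.ofReal ((‖f (η * Complex.I)‖ + 1) ^ s / Real.cos (Real.pi * s / 2)) := by
  have hcos : 0 < Real.cos (Real.pi * s / 2) := Real.cos_pos_of_mem_Ioo
    ⟨by nlinarith [Real.pi_pos], by nlinarith [Real.pi_pos]⟩
  -- Adding `i` turns `Im f ≥ 0` into the strict positivity needed for the power, and can only
  -- increase the norm.
  have hfI : DifferentiableOn ℂ (fun z => f z + Complex.I) {z | -ε < z.im} := hf.add_const _
  have hq : ContinuousOn (fun z => ‖f z + Complex.I‖ ^ s) {z | -ε < z.im} :=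
    hfI.continuousOn.norm.rpow_const fun _ _ => Or.inr hs.le
  have hnI : ∀ z, ‖f z + Complex.I‖ ≤ ‖f z‖ + 1 := fun z => by
    simpa using norm_add_le (f z) Complex.I
  have hqC : ∀ z : ℂ, 0 ≤ z.im → |‖f z + Complex.I‖ ^ s| ≤ (C + 1) ^ s := fun z hz => by
    rw [abs_of_nonneg (by positivity)]
    exact Real.rpow_le_rpow (norm_nonneg _) ((hnI z).trans (by linarith [hC z hz])) hs.le
  have h1 : ∫⁻ ξ : ℝ, ENNReal.ofReal (‖f ξ‖ ^ s) ∂(poissonMeasure η)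
      ≤ ∫⁻ ξ : ℝ, ENNReal.ofReal (‖f ξ + Complex.I‖ ^ s) ∂(poissonMeasure η) := by
    refine lintegral_mono fun ξ => ENNReal.ofReal_le_ofReal
      (Real.rpow_le_rpow (norm_nonneg _) ?_ hs.le)
    have := him ξ (by simp)
    rw [Complex.norm_eq_sqrt_sq_add_sq, Complex.norm_eq_sqrt_sq_add_sq]
    apply Real.sqrt_le_sqrt
    simp
    nlinarith
  refine h1.trans ?_
  rw [← ofReal_integral_tan_eq hη hε hq hqC fun z => by positivity]
  refine ENNReal.ofReal_le_ofReal (le_of_tendsto (tendsto_circleAverage_mobius hη hε hq hqC) ?_)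
  filter_upwards [show Set.Ioo (0 : ℝ) 1 ∈ 𝓝[<] (1 : ℝ) from Ioo_mem_nhdsLT (by norm_num)] with t ht
  have := circleAverage_norm_rpow_le ht.1 hs hs1 (analyticOnNhd_comp_mobius hη hε ht.2 hfI) ?_
  · rw [mobius_zero] at this
    refine this.trans ?_
    gcongr
    exact hnI _
  · intro w hw
    have hw1 : ‖w‖ < 1 := (mem_closedBall_zero_iff.1 hw).trans_lt ht.2
    have := him _ (mobius_im_pos hη hw1).le
    simp only [Complex.add_im, Complex.I_im]
    linarith

/-! ### The exponentially weighted estimate -/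

/-- Away from the origin, harmonic measures seen from low points are dominated. -/
theorem setLIntegral_poissonMeasure_le {η ρ : ℝ} (hη : 0 < η) (hηρ : η ≤ ρ / 2) {g : ℝ → ℝ≥0∞}
    (hg : Measurable g) :
    ∫⁻ ξ in {ξ : ℝ | ρ ≤ |ξ|}, g ξ ∂(poissonMeasure η) ≤ ∫⁻ ξ, g ξ ∂(poissonMeasure ρ) := by
  have hρ : 0 < ρ := by linarith
  have hS : MeasurableSet {ξ : ℝ | ρ ≤ |ξ|} := measurableSet_le measurable_const (by fun_prop)
  rw [← lintegral_indicator hS, poissonMeasure, poissonMeasure,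
    lintegral_withDensity_eq_lintegral_mul _ (by fun_prop) (hg.indicator hS),
    lintegral_withDensity_eq_lintegral_mul _ (by fun_prop) hg]
  refine lintegral_mono fun ξ => ?_
  simp only [Pi.mul_apply, Set.indicator_apply, Set.mem_ofPred_eq]
  split_ifs with h
  · gcongr ENNReal.ofReal ?_ * _
    have hpi := Real.pi_pos
    have h2 : ρ ^ 2 ≤ ξ ^ 2 := by rw [← sq_abs ξ]; gcongr
    rw [div_le_div_iff₀ (by positivity) (by positivity)]
    -- The difference of the two sides is `(ρ - η)(ξ² - ηρ)`. Comparing with the kernel seen from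
    -- `iρ` keeps the far contribution bounded as `η → 0`.
    have : η * (ξ ^ 2 + ρ ^ 2) ≤ ρ * (ξ ^ 2 + η ^ 2) := by
      nlinarith [sq_nonneg ξ, sq_nonneg η, mul_nonneg hη.le (sq_nonneg ξ)]
    nlinarith
  · simp

/-- Exponentially weighted sub-mean value property on the half plane: a boundary contribution near
the origin may be traded for exponential decay. -/
theorem norm_rpow_mul_exp_le_lintegral_poisson {η ρ ε C s a : ℝ} (hη : 0 < η) (hηρ : η ≤ ρ / 2)
    (hε : 0 < ε) (hs : 0 < s) (ha : 0 ≤ a) {g : ℂ → ℂ}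
    (hg : DifferentiableOn ℂ g {z | -ε < z.im}) (hC : ∀ z : ℂ, 0 ≤ z.im → ‖g z‖ ≤ C) :
    ENNReal.ofReal (‖g (η * Complex.I)‖ ^ s) * ENNReal.ofReal (Real.exp (a / 3))
      ≤ ENNReal.ofReal (Real.exp a) * ∫⁻ ξ in {ξ : ℝ | |ξ| < ρ},
          ENNReal.ofReal (‖g ξ‖ ^ s) ∂(poissonMeasure η)
        + ∫⁻ ξ : ℝ, ENNReal.ofReal (‖g ξ‖ ^ s) ∂(poissonMeasure ρ) := by
  have hρ : 0 < ρ := by linarith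
  -- On the real line `Re Φ = ρ²/(ξ² + ρ²) - 1/2`, which changes sign exactly at `|ξ| = ρ`. The
  -- factor `2a/s` gives `‖exp((2a/s) Φ)‖ ^ s = exp (2a Re Φ)`.
  let Φ : ℂ → ℂ := fun z => Complex.I * ρ / (z + Complex.I * ρ) - 1 / 2
  let f : ℂ → ℂ := fun z => g z * Complex.exp ((2 * a / s : ℝ) * Φ z)
  -- `Φ` has its pole at `-iρ`, so the strip below the axis is shrunk to avoid it.
  have hδ : 0 < min ε ρ := lt_min hε hρ
  have hne : ∀ z : ℂ, -ρ < z.im → z + Complex.I * ρ ≠ 0 := by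
    intro z hz h
    have := congrArg Complex.im h
    simp at this
    linarith
  have hf : DifferentiableOn ℂ f {z | -(min ε ρ) < z.im} := by
    refine (hg.mono fun z hz => ?_).mul (DifferentiableOn.cexp (DifferentiableOn.const_mul
      (DifferentiableOn.sub_const (DifferentiableOn.div (by fun_prop) (by fun_prop) ?_) _) _))
    · simp only [Set.mem_ofPred_eq] at hz ⊢
      linarith [min_le_left ε ρ]
    · intro z hz
      simp only [Set.mem_ofPred_eq] at hz
      exact hne z (by linarith [min_le_right ε ρ])
  have hnorm : ∀ z, ‖f z‖ ^ s = ‖g z‖ ^ s * Real.exp (2 * a * (Φ z).re) := by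
    intro z
    rw [norm_mul, Complex.norm_exp, Complex.re_ofReal_mul,
      Real.mul_rpow (norm_nonneg _) (Real.exp_pos _).le, ← Real.exp_mul]
    congr 2
    field_simp
  have hre : ∀ z : ℂ, (Φ z).re
      = ρ * (z.im + ρ) / (z.re ^ 2 + (z.im + ρ) ^ 2) - 1 / 2 := by
    intro z
    simp only [Φ, Complex.sub_re, Complex.div_re, Complex.normSq_apply]
    simp
    ring_nf
  have hre_le : ∀ z : ℂ, 0 ≤ z.im → (Φ z).re ≤ 1 / 2 := by
    intro z hz
    rw [hre, sub_le_iff_le_add, div_le_iff₀ (by positivity)]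
    nlinarith [sq_nonneg z.re]
  have hC0 : 0 ≤ C := (norm_nonneg _).trans (hC 0 (by simp))
  have hfC : ∀ z : ℂ, 0 ≤ z.im → ‖f z‖ ≤ C * Real.exp (2 * a / s * (1 / 2)) := by
    intro z hz
    rw [norm_mul, Complex.norm_exp, Complex.re_ofReal_mul]
    have := hre_le z hz
    gcongr
    exact hC z hz
  have hmain := norm_rpow_le_lintegral_poisson hη hδ hs hf hfC
  have hgc : Continuous fun ξ : ℝ => ‖g ξ‖ ^ s :=
    (continuous_comp_ofReal (q := fun z => ‖g z‖ ^ s) hε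
      (hg.continuousOn.norm.rpow_const fun _ _ => Or.inr hs.le))
  have hS : MeasurableSet {ξ : ℝ | |ξ| < ρ} := measurableSet_lt (by fun_prop) measurable_const
  have hSc : {ξ : ℝ | |ξ| < ρ}ᶜ = {ξ : ℝ | ρ ≤ |ξ|} := by
    ext ξ
    simp
  calc ENNReal.ofReal (‖g (η * Complex.I)‖ ^ s) * ENNReal.ofReal (Real.exp (a / 3))
      ≤ ENNReal.ofReal (‖f (η * Complex.I)‖ ^ s) := by
        rw [hnorm, ENNReal.ofReal_mul (by positivity)]
        refine mul_le_mul' le_rfl (ENNReal.ofReal_le_ofReal (Real.exp_le_exp.2 ?_))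
        -- At `iη` the value is `ρ/(η + ρ) - 1/2`, and `η ≤ ρ/2` gives `2/3 - 1/2`.
        have h1 : 1 / 6 ≤ (Φ (η * Complex.I)).re := by
          rw [hre, le_sub_iff_add_le]
          simp only [Complex.re_ofReal_mul, Complex.im_ofReal_mul, Complex.I_re, Complex.I_im]
          rw [le_div_iff₀ (by positivity)]
          nlinarith
        nlinarith
    _ ≤ ∫⁻ ξ : ℝ, ENNReal.ofReal (‖f ξ‖ ^ s) ∂(poissonMeasure η) := hmain
    _ = ∫⁻ ξ in {ξ : ℝ | |ξ| < ρ}, ENNReal.ofReal (‖f ξ‖ ^ s) ∂(poissonMeasure η)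
        + ∫⁻ ξ in {ξ : ℝ | ρ ≤ |ξ|}, ENNReal.ofReal (‖f ξ‖ ^ s) ∂(poissonMeasure η) := by
        rw [← hSc, lintegral_add_compl _ hS]
    _ ≤ _ := by
        refine add_le_add ?_ (le_trans ?_ (setLIntegral_poissonMeasure_le hη hηρ
          hgc.measurable.ennreal_ofReal))
        · rw [← lintegral_const_mul _ hgc.measurable.ennreal_ofReal]
          refine lintegral_mono fun ξ => ?_
          rw [← ENNReal.ofReal_mul (by positivity), hnorm, mul_comm]
          refine ENNReal.ofReal_le_ofReal (mul_le_mul_of_nonneg_right ?_ (by positivity))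
          gcongr
          have := hre_le ξ (by simp)
          nlinarith
        · refine setLIntegral_mono (hgc.measurable.ennreal_ofReal) fun ξ hξ => ?_
          refine ENNReal.ofReal_le_ofReal ?_
          rw [hnorm]
          refine mul_le_of_le_one_right (by positivity) (Real.exp_le_one_iff.2 ?_)
          have h1 : (Φ ξ).re ≤ 0 := by
            rw [hre, sub_nonpos]
            simp only [Complex.ofReal_re, Complex.ofReal_im, zero_add]
            have h2 : ρ ^ 2 ≤ ξ ^ 2 := by
              rw [← sq_abs ξ]
              have : ρ ≤ |ξ| := hξ
              gcongr
            rw [div_le_div_iff₀ (by positivity) (by positivity)]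
            nlinarith
          nlinarith

/-! ### Resolvents of bounded self-adjoint operators -/

/-- Only diagonal matrix elements have a signed imaginary part. Polarization reduces to them, the
factor `1/4` is discarded, and `t ↦ t ^ s` is subadditive. -/
theorem norm_inner_rpow_le_polarization {𝓗 : Type*} [NormedAddCommGroup 𝓗]
    [InnerProductSpace ℂ 𝓗] {s : ℝ} (hs : 0 < s) (hs1 : s < 1) (R : 𝓗 →L[ℂ] 𝓗)
    (x y : 𝓗) :
    ‖inner ℂ x (R y)‖ ^ s ≤ ‖inner ℂ (x + y) (R (x + y))‖ ^ s + ‖inner ℂ (x - y) (R (x - y))‖ ^ s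
      + ‖inner ℂ (x + Complex.I • y) (R (x + Complex.I • y))‖ ^ s
      + ‖inner ℂ (x - Complex.I • y) (R (x - Complex.I • y))‖ ^ s := by
  have h := inner_map_polarization (R : 𝓗 →ₗ[ℂ] 𝓗) x y
  simp only [ContinuousLinearMap.coe_coe] at h
  have hsub : ∀ {a b : ℝ}, 0 ≤ a → 0 ≤ b → (a + b) ^ s ≤ a ^ s + b ^ s := fun ha hb =>
    Real.rpow_add_le_add_rpow ha hb hs.le hs1.le
  rw [norm_inner_symm, h, norm_inner_symm (x + y), norm_inner_symm (x - y),
    norm_inner_symm (x + Complex.I • y), norm_inner_symm (x - Complex.I • y)]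
  set a := inner ℂ (R (x + y)) (x + y)
  set b := inner ℂ (R (x - y)) (x - y)
  set c := inner ℂ (R (x + Complex.I • y)) (x + Complex.I • y)
  set d := inner ℂ (R (x - Complex.I • y)) (x - Complex.I • y)
  have h1 : ‖(a - b + Complex.I * c - Complex.I * d) / 4‖ ≤ ‖a‖ + ‖b‖ + ‖c‖ + ‖d‖ := by
    have e1 := norm_sub_le (a - b + Complex.I * c) (Complex.I * d)
    have e2 := norm_add_le (a - b) (Complex.I * c)
    have e3 := norm_sub_le a b
    rw [norm_mul, Complex.norm_I, one_mul] at e1 e2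
    rw [norm_div]
    have : ‖(4 : ℂ)‖ = 4 := by norm_num
    rw [this]
    have := norm_nonneg (a - b + Complex.I * c - Complex.I * d)
    linarith
  refine (Real.rpow_le_rpow (norm_nonneg _) h1 hs.le).trans ?_
  have e1 := hsub (a := ‖a‖ + ‖b‖ + ‖c‖) (b := ‖d‖) (by positivity) (by positivity)
  have e2 := hsub (a := ‖a‖ + ‖b‖) (b := ‖c‖) (by positivity) (by positivity)
  have e3 := hsub (a := ‖a‖) (b := ‖b‖) (by positivity) (by positivity)
  linarith

section Resolvent

variable {𝓗 : Type*} [NormedAddCommGroup 𝓗] [InnerProductSpace ℂ 𝓗] [CompleteSpace 𝓗]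

/-- The resolvent `(T - z)⁻¹`. -/
def resolventOp (T : 𝓗 →L[ℂ] 𝓗) (z : ℂ) : 𝓗 →L[ℂ] 𝓗 :=
  Ring.inverse (T - z • ContinuousLinearMap.id ℂ 𝓗)

theorem isUnit_sub_smul_id {T : 𝓗 →L[ℂ] 𝓗} (hT : IsSelfAdjoint T) {z : ℂ} (hz : z.im ≠ 0) :
    IsUnit (T - z • ContinuousLinearMap.id ℂ 𝓗) := by
  have h : z ∉ spectrum ℂ T := fun h => hz (hT.im_eq_zero_of_mem_spectrum h)
  have h2 : IsUnit (algebraMap ℂ (𝓗 →L[ℂ] 𝓗) z - T) := not_not.1 h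
  have h3 := h2.neg
  rwa [neg_sub, Algebra.algebraMap_eq_smul_one] at h3

theorem im_inner_sub_smul_id {T : 𝓗 →L[ℂ] 𝓗} (hT : IsSelfAdjoint T) (z : ℂ) (u : 𝓗) :
    (inner ℂ ((T - z • ContinuousLinearMap.id ℂ 𝓗) u) u).im = z.im * ‖u‖ ^ 2 := by
  have h1 : (inner ℂ (T u) u).im = 0 := by
    have := hT.isSymmetric.im_inner_apply_self u
    simpa using this
  simp only [sub_apply, smul_apply, ContinuousLinearMap.id_apply, inner_sub_left, inner_smul_left,
    Complex.sub_im, h1, inner_self_eq_norm_sq_to_K, Complex.coe_algebraMap]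
  rw [← Complex.ofReal_pow, Complex.im_mul_ofReal]
  simp

theorem abs_im_mul_norm_le {T : 𝓗 →L[ℂ] 𝓗} (hT : IsSelfAdjoint T) (z : ℂ) (u : 𝓗) :
    |z.im| * ‖u‖ ≤ ‖(T - z • ContinuousLinearMap.id ℂ 𝓗) u‖ := by
  rcases eq_or_ne u 0 with rfl | hu
  · simp
  have hu0 : 0 < ‖u‖ := norm_pos_iff.2 hu
  have h1 := im_inner_sub_smul_id hT z u
  have h2 := (Complex.abs_im_le_norm _).trans
    (norm_inner_le_norm (𝕜 := ℂ) ((T - z • ContinuousLinearMap.id ℂ 𝓗) u) u)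
  rw [h1, abs_mul, abs_of_nonneg (sq_nonneg ‖u‖)] at h2
  nlinarith

theorem sub_smul_id_resolventOp {T : 𝓗 →L[ℂ] 𝓗} (hT : IsSelfAdjoint T) {z : ℂ} (hz : z.im ≠ 0)
    (φ : 𝓗) : (T - z • ContinuousLinearMap.id ℂ 𝓗) (resolventOp T z φ) = φ := by
  have := Ring.mul_inverse_cancel _ (isUnit_sub_smul_id hT hz)
  exact congrArg (fun A : 𝓗 →L[ℂ] 𝓗 => A φ) this

theorem resolventOp_sub_smul_id {T : 𝓗 →L[ℂ] 𝓗} (hT : IsSelfAdjoint T) {z : ℂ} (hz : z.im ≠ 0)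
    (φ : 𝓗) : resolventOp T z ((T - z • ContinuousLinearMap.id ℂ 𝓗) φ) = φ := by
  have := Ring.inverse_mul_cancel _ (isUnit_sub_smul_id hT hz)
  exact congrArg (fun A : 𝓗 →L[ℂ] 𝓗 => A φ) this

theorem norm_resolventOp_apply_le {T : 𝓗 →L[ℂ] 𝓗} (hT : IsSelfAdjoint T) {z : ℂ} (hz : z.im ≠ 0)
    (φ : 𝓗) : ‖resolventOp T z φ‖ ≤ ‖φ‖ / |z.im| := by
  rw [le_div_iff₀' (abs_pos.2 hz)]
  have := abs_im_mul_norm_le hT z (resolventOp T z φ)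
  rwa [sub_smul_id_resolventOp hT hz] at this

theorem norm_inner_resolventOp_le {T : 𝓗 →L[ℂ] 𝓗} (hT : IsSelfAdjoint T) {z : ℂ} (hz : z.im ≠ 0)
    (x y : 𝓗) : ‖inner ℂ x (resolventOp T z y)‖ ≤ ‖x‖ * ‖y‖ / |z.im| := by
  refine (norm_inner_le_norm _ _).trans ?_
  rw [mul_div_assoc]
  gcongr
  exact norm_resolventOp_apply_le hT hz y

/-- With `u = (T - z)⁻¹ ψ` the imaginary part equals `Im z ‖u‖²`. This is what makes Kolmogorov's
inequality applicable. -/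
theorem im_inner_resolventOp_nonneg {T : 𝓗 →L[ℂ] 𝓗} (hT : IsSelfAdjoint T) {z : ℂ} (hz : 0 < z.im)
    (ψ : 𝓗) : 0 ≤ (inner ℂ ψ (resolventOp T z ψ)).im := by
  have := im_inner_sub_smul_id hT z (resolventOp T z ψ)
  rw [sub_smul_id_resolventOp hT hz.ne'] at this
  rw [this]
  positivity

theorem differentiableAt_inner_resolventOp {T : 𝓗 →L[ℂ] 𝓗} (hT : IsSelfAdjoint T) {z : ℂ}
    (hz : z.im ≠ 0) (x y : 𝓗) :
    DifferentiableAt ℂ (fun z => inner ℂ x (resolventOp T z y)) z := by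
  have h1 : DifferentiableAt ℂ (fun z => resolventOp T z) z := by
    obtain ⟨u, hu⟩ := isUnit_sub_smul_id hT hz
    have h2 : DifferentiableAt ℂ (@Ring.inverse (𝓗 →L[ℂ] 𝓗) _)
        (T - z • ContinuousLinearMap.id ℂ 𝓗) := hu ▸ differentiableAt_inverse ⟨u, rfl⟩
    exact h2.comp z (f := fun z : ℂ => T - z • ContinuousLinearMap.id ℂ 𝓗) (by fun_prop)
  exact (innerSL ℂ x).differentiableAt.comp z (h1.clm_apply (differentiableAt_const y))

/-- The resolvent at the conjugate of `z` is the adjoint of the resolvent at `z`. -/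
theorem norm_inner_resolventOp_conj {T : 𝓗 →L[ℂ] 𝓗} (hT : IsSelfAdjoint T) {z : ℂ}
    (hz : z.im ≠ 0) (x y : 𝓗) :
    ‖inner ℂ x (resolventOp T (starRingEnd ℂ z) y)‖ = ‖inner ℂ y (resolventOp T z x)‖ := by
  have hz' : (starRingEnd ℂ z).im ≠ 0 := by simpa using hz
  have h : inner ℂ x (resolventOp T (starRingEnd ℂ z) y) = inner ℂ (resolventOp T z x) y := by
    conv_lhs => rw [← sub_smul_id_resolventOp hT hz x]
    conv_rhs => rw [← sub_smul_id_resolventOp hT hz' y]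
    have := hT.isSymmetric (resolventOp T z x) (resolventOp T (starRingEnd ℂ z) y)
    simp only [ContinuousLinearMap.coe_coe] at this
    simp only [sub_apply, smul_apply, ContinuousLinearMap.id_apply, inner_sub_left, inner_sub_right,
      inner_smul_left, inner_smul_right, this]
  rw [h, norm_inner_symm]

theorem differentiableOn_inner_resolventOp_shift {T : 𝓗 →L[ℂ] 𝓗} (hT : IsSelfAdjoint T)
    (E ε : ℝ) (x y : 𝓗) :
    DifferentiableOn ℂ (fun z => inner ℂ x (resolventOp T (E + z + ε * Complex.I) y))
      {z | -ε < z.im} := by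
  intro z hz
  refine DifferentiableAt.differentiableWithinAt ?_
  refine DifferentiableAt.comp z (g := fun z => inner ℂ x (resolventOp T z y))
    (f := fun z : ℂ => E + z + ε * Complex.I) (differentiableAt_inner_resolventOp hT ?_ x y)
    (by fun_prop)
  simp only [Set.mem_ofPred_eq] at hz
  simp
  linarith

theorem norm_inner_resolventOp_shift_le {T : 𝓗 →L[ℂ] 𝓗} (hT : IsSelfAdjoint T) {E ε δ : ℝ}
    (hδ : 0 < δ) (x y : 𝓗) {z : ℂ} (hz : δ ≤ z.im + ε) :
    ‖inner ℂ x (resolventOp T (E + z + ε * Complex.I) y)‖ ≤ ‖x‖ * ‖y‖ / δ := by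
  have him : (E + z + ε * Complex.I).im = z.im + ε := by simp
  refine (norm_inner_resolventOp_le hT (by rw [him]; linarith) x y).trans ?_
  rw [him, abs_of_pos (by linarith)]
  gcongr

/-- A-priori bound on fractional moments of the resolvent, averaged over the energy. -/
theorem lintegral_poisson_resolventOp_le {T : 𝓗 →L[ℂ] 𝓗} (hT : IsSelfAdjoint T) {E ε η s : ℝ}
    (hε : 0 < ε) (hη : 0 < η) (hs : 0 < s) (hs1 : s < 1) {x y : 𝓗} (hx : ‖x‖ ≤ 1) (hy : ‖y‖ ≤ 1) :
    ∫⁻ ξ : ℝ, ENNReal.ofReal (‖inner ℂ x (resolventOp T (E + ξ + ε * Complex.I) y)‖ ^ s)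
        ∂(poissonMeasure η)
      ≤ 4 * ENNReal.ofReal ((4 / η + 1) ^ s / Real.cos (Real.pi * s / 2)) := by
  have hcos : 0 < Real.cos (Real.pi * s / 2) := Real.cos_pos_of_mem_Ioo
    ⟨by nlinarith [Real.pi_pos], by nlinarith [Real.pi_pos]⟩
  have key : ∀ ψ : 𝓗, ‖ψ‖ ≤ 2 →
      ∫⁻ ξ : ℝ, ENNReal.ofReal (‖inner ℂ ψ (resolventOp T (E + ξ + ε * Complex.I) ψ)‖ ^ s)
        ∂(poissonMeasure η) ≤ ENNReal.ofReal ((4 / η + 1) ^ s / Real.cos (Real.pi * s / 2)) := by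
    intro ψ hψ
    refine (lintegral_poisson_norm_rpow_le hη hε hs hs1
      (differentiableOn_inner_resolventOp_shift hT E ε ψ ψ) (C := ‖ψ‖ * ‖ψ‖ / ε)
      (fun z hz => norm_inner_resolventOp_shift_le hT hε ψ ψ (by linarith))
      (fun z hz => im_inner_resolventOp_nonneg hT (by simp; linarith) ψ)).trans ?_
    gcongr
    refine (norm_inner_resolventOp_shift_le hT hη ψ ψ (by simp; linarith)).trans ?_
    gcongr
    nlinarith [norm_nonneg ψ]
  have hmeas : ∀ ψ : 𝓗, Measurable fun ξ : ℝ =>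
      ENNReal.ofReal (‖inner ℂ ψ (resolventOp T (E + ξ + ε * Complex.I) ψ)‖ ^ s) := fun ψ =>
    (continuous_comp_ofReal (q := fun z => ‖inner ℂ ψ (resolventOp T (E + z + ε * Complex.I) ψ)‖ ^ s)
      hε ((differentiableOn_inner_resolventOp_shift hT E ε ψ ψ).continuousOn.norm.rpow_const
        fun _ _ => Or.inr hs.le)).measurable.ennreal_ofReal
  have hI : ‖Complex.I • y‖ ≤ 1 := by rwa [norm_smul, Complex.norm_I, one_mul]
  calc _ ≤ ∫⁻ ξ : ℝ,
        (ENNReal.ofReal (‖inner ℂ (x + y) (resolventOp T (E + ξ + ε * Complex.I) (x + y))‖ ^ s)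
        + ENNReal.ofReal (‖inner ℂ (x - y) (resolventOp T (E + ξ + ε * Complex.I) (x - y))‖ ^ s)
        + ENNReal.ofReal (‖inner ℂ (x + Complex.I • y)
            (resolventOp T (E + ξ + ε * Complex.I) (x + Complex.I • y))‖ ^ s)
        + ENNReal.ofReal (‖inner ℂ (x - Complex.I • y)
            (resolventOp T (E + ξ + ε * Complex.I) (x - Complex.I • y))‖ ^ s))
          ∂(poissonMeasure η) := by
        refine lintegral_mono fun ξ => ?_
        rw [← ENNReal.ofReal_add (by positivity) (by positivity),
          ← ENNReal.ofReal_add (by positivity) (by positivity),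
          ← ENNReal.ofReal_add (by positivity) (by positivity)]
        exact ENNReal.ofReal_le_ofReal (norm_inner_rpow_le_polarization hs hs1 _ x y)
    _ ≤ _ := by
        rw [lintegral_add_right _ (hmeas _), lintegral_add_right _ (hmeas _),
          lintegral_add_right _ (hmeas _)]
        have h1 := key (x + y) ((norm_add_le _ _).trans (by linarith))
        have h2 := key (x - y) ((norm_sub_le _ _).trans (by linarith))
        have h3 := key (x + Complex.I • y) ((norm_add_le _ _).trans (by linarith))
        have h4 := key (x - Complex.I • y) ((norm_sub_le _ _).trans (by linarith))
        refine (add_le_add (add_le_add (add_le_add h1 h2) h3) h4).trans (le_of_eq ?_)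
        ring

end Resolvent

/-! ### The lattice Hamiltonian and the Combes–Thomas estimate -/

section Lattice

variable {d : ℕ}

theorem latticeDist_eq_dist (x y : Site d) :
    latticeDist x y = dist (WithLp.toLp 2 fun i => (x i : ℝ) : EuclideanSpace ℝ (Fin d))
      (WithLp.toLp 2 fun i => (y i : ℝ)) := by
  rw [EuclideanSpace.dist_eq, latticeDist]
  simp [Real.dist_eq, sq_abs]

theorem latticeDist_nonneg (x y : Site d) : 0 ≤ latticeDist x y := Real.sqrt_nonneg _

theorem latticeDist_comm (x y : Site d) : latticeDist x y = latticeDist y x := by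
  rw [latticeDist_eq_dist, dist_comm, ← latticeDist_eq_dist]

theorem latticeDist_self (x : Site d) : latticeDist x x = 0 := by
  simp [latticeDist]

theorem abs_latticeDist_sub_le (x x' y : Site d) :
    |latticeDist x y - latticeDist x' y| ≤ latticeDist x x' := by
  simp only [latticeDist_eq_dist]
  exact abs_dist_sub_le _ _ _

theorem latticeDist_add_single (x : Site d) (i : Fin d) (c : ℤ) :
    latticeDist x (x + Pi.single i c) = |(c : ℝ)| := by
  rw [latticeDist, Finset.sum_eq_single i]
  · simp [Real.sqrt_sq_eq_abs]
  · intro j _ hj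
    simp [Pi.single_eq_of_ne hj]
  · simp

theorem shift_apply (a : Site d) (ψ : L2 d) (x : Site d) :
    (shift a ψ : Site d → ℂ) x = ψ (x + a) := rfl

theorem norm_shift_apply_le (a : Site d) (ψ : L2 d) : ‖shift a ψ‖ ≤ ‖ψ‖ := by
  have := (shift a).le_of_opNorm_le (LinearMap.mkContinuous_norm_le _ zero_le_one _) ψ
  rwa [one_mul] at this

theorem adjoint_shift (a : Site d) : ContinuousLinearMap.adjoint (shift a) = shift (-a) := by
  refine Eq.symm ((ContinuousLinearMap.eq_adjoint_iff _ _).2 fun φ ψ => ?_)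
  rw [lp.inner_eq_tsum, lp.inner_eq_tsum, ← (Equiv.addRight a).tsum_eq]
  refine tsum_congr fun x => ?_
  simp [shift_apply]

theorem isSelfAdjoint_laplacian (d : ℕ) : IsSelfAdjoint (laplacian d) := by
  rw [laplacian]
  refine isSelfAdjoint_sum _ fun i _ => ?_
  rw [IsSelfAdjoint, star_sub, star_add, star_smul, ContinuousLinearMap.star_eq_adjoint,
    ContinuousLinearMap.star_eq_adjoint, adjoint_shift, adjoint_shift, neg_neg, add_comm]
  have h1 : star (ContinuousLinearMap.id ℂ (L2 d)) = ContinuousLinearMap.id ℂ (L2 d) :=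
    star_one (L2 d →L[ℂ] L2 d)
  rw [h1]
  simp

theorem potentialOp_apply {v : Site d → ℝ} (hv : ∃ C, ∀ x, |v x| ≤ C) (ψ : L2 d) (x : Site d) :
    (potentialOp v ψ : Site d → ℂ) x = v x * ψ x := by
  rw [potentialOp, dif_pos hv]
  rfl

theorem isSelfAdjoint_potentialOp (v : Site d → ℝ) : IsSelfAdjoint (potentialOp v) := by
  by_cases hv : ∃ C, ∀ x, |v x| ≤ C
  · refine Eq.symm ((ContinuousLinearMap.eq_adjoint_iff _ _).2 fun φ ψ => ?_)
    rw [lp.inner_eq_tsum, lp.inner_eq_tsum]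
    refine tsum_congr fun x => ?_
    simp only [potentialOp_apply hv, RCLike.inner_apply, map_mul, Complex.conj_ofReal]
    ring
  · rw [potentialOp, dif_neg hv]
    exact IsSelfAdjoint.zero _

theorem isSelfAdjoint_hamiltonian (v : Site d → ℝ) : IsSelfAdjoint (hamiltonian v) :=
  (isSelfAdjoint_laplacian d).neg.add (isSelfAdjoint_potentialOp v)

theorem norm_delta (x : Site d) : ‖delta x‖ = 1 := by
  rw [delta, lp.norm_single (by norm_num), norm_one]

theorem inner_delta (x : Site d) (ψ : L2 d) : inner ℂ (delta x) ψ = ψ x := by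
  rw [delta, lp.inner_single_left]
  simp

theorem green_eq (v : Site d → ℝ) (x y : Site d) (z : ℂ) :
    green v x y z = inner ℂ (delta x) (resolventOp (hamiltonian v) z (delta y)) := rfl

theorem potentialOp_comm (v w : Site d → ℝ) (ψ : L2 d) :
    potentialOp v (potentialOp w ψ) = potentialOp w (potentialOp v ψ) := by
  by_cases hv : ∃ C, ∀ x, |v x| ≤ C
  · by_cases hw : ∃ C, ∀ x, |w x| ≤ C
    · ext x
      simp only [potentialOp_apply hv, potentialOp_apply hw]
      ring
    · simp [potentialOp, dif_neg hw]
  · simp [potentialOp, dif_neg hv]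

/-- The commutator sends `ψ` to `(w(x) - w(x + a)) ψ(x + a)`. The bound is relative to `wψ` rather
than `ψ`, so that it can later be absorbed. -/
theorem norm_commutator_shift_le {w : Site d → ℝ} (hw : ∃ C, ∀ x, |w x| ≤ C) {κ : ℝ} (hκ : 0 ≤ κ)
    (a : Site d) (ha : ∀ x, |w x - w (x + a)| ≤ κ * |w (x + a)|) (ψ : L2 d) :
    ‖potentialOp w (shift a ψ) - shift a (potentialOp w ψ)‖ ≤ κ * ‖potentialOp w ψ‖ := by
  have h1 : ‖potentialOp w (shift a ψ) - shift a (potentialOp w ψ)‖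
      ≤ ‖(κ : ℂ) • shift a (potentialOp w ψ)‖ := by
    refine lp.norm_mono (by norm_num) fun x => ?_
    rw [lp.coeFn_sub, lp.coeFn_smul, Pi.sub_apply, Pi.smul_apply, shift_apply,
      potentialOp_apply hw, potentialOp_apply hw, shift_apply, ← sub_mul, smul_eq_mul, norm_mul,
      norm_mul, norm_mul, ← Complex.ofReal_sub, Complex.norm_real, Complex.norm_real,
      Complex.norm_real, ← mul_assoc, Real.norm_eq_abs, Real.norm_eq_abs, Real.norm_eq_abs,
      abs_of_nonneg hκ]
    exact mul_le_mul_of_nonneg_right (ha x) (norm_nonneg _)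
  refine h1.trans ?_
  rw [norm_smul, Complex.norm_real, Real.norm_eq_abs, abs_of_nonneg hκ]
  gcongr
  exact norm_shift_apply_le _ _

theorem hamiltonian_sub_smul_potentialOp (v w : Site d → ℝ) (z : ℂ) (ψ : L2 d) :
    (hamiltonian v - z • ContinuousLinearMap.id ℂ (L2 d)) (potentialOp w ψ)
      = potentialOp w ((hamiltonian v - z • ContinuousLinearMap.id ℂ (L2 d)) ψ)
        + ∑ i : Fin d, ((potentialOp w (shift (Pi.single i 1) ψ)
            - shift (Pi.single i 1) (potentialOp w ψ))
          + (potentialOp w (shift (-Pi.single i 1) ψ)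
            - shift (-Pi.single i 1) (potentialOp w ψ))) := by
  simp only [hamiltonian, laplacian, sub_apply, add_apply, neg_apply, sum_apply,
    smul_apply, ContinuousLinearMap.id_apply, map_sub, map_add, map_neg, map_sum, map_smul,
    potentialOp_comm v w, Finset.sum_add_distrib, Finset.sum_sub_distrib]
  abel

theorem potentialOp_delta {w : Site d → ℝ} (hw : ∃ C, ∀ x, |w x| ≤ C) {y : Site d} (hy : w y = 1) :
    potentialOp w (delta y) = delta y := by
  ext x
  rw [potentialOp_apply hw, delta, lp.coeFn_single]
  by_cases h : x = y
  · subst h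
    simp [hy]
  · simp [Pi.single_eq_of_ne h]

/-- The Combes–Thomas estimate. -/
theorem norm_green_le_exp (v : Site d → ℝ) (x y : Site d) {z : ℂ} (hz : z.im ≠ 0) {ν : ℝ}
    (hν : 0 ≤ ν) (hνz : 2 * d * (Real.exp ν - 1) ≤ |z.im| / 2) :
    ‖green v x y z‖ ≤ 2 / |z.im| * Real.exp (-ν * latticeDist x y) := by
  -- Truncating the distance at `|x - y|` makes the weight `w` bounded while keeping its full size
  -- at `x`.
  let u : Site d → ℝ := fun x' => min (latticeDist x' y) (latticeDist x y)
  let w : Site d → ℝ := fun x' => Real.exp (ν * u x')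
  have hw : ∃ C, ∀ x, |w x| ≤ C := by
    refine ⟨Real.exp (ν * latticeDist x y), fun x' => ?_⟩
    rw [abs_of_pos (Real.exp_pos _)]
    simp only [u]
    gcongr
    exact min_le_right _ _
  have hκ : 0 ≤ Real.exp ν - 1 := by linarith [Real.one_le_exp hν]
  have hwa : ∀ a : Site d, (∀ x, latticeDist x (x + a) ≤ 1) →
      ∀ x, |w x - w (x + a)| ≤ (Real.exp ν - 1) * |w (x + a)| := by
    intro a ha x'
    have hu : |u x' - u (x' + a)| ≤ 1 :=
      (abs_min_sub_min_le_max _ _ _ _).trans (max_le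
        ((abs_latticeDist_sub_le _ _ _).trans (ha x')) (by simp))
    have e : w x' = w (x' + a) * Real.exp (ν * (u x' - u (x' + a))) := by
      simp only [w]
      rw [← Real.exp_add]
      ring_nf
    rw [e, ← mul_sub_one, abs_mul, mul_comm]
    gcongr
    have h2 : |ν * (u x' - u (x' + a))| ≤ ν := by
      rw [abs_mul, abs_of_nonneg hν]
      nlinarith
    obtain ⟨h3, h4⟩ := abs_le.1 h2
    rw [abs_le]
    constructor
    · have h5 := Real.add_one_le_exp ν
      have h6 := Real.exp_le_exp.2 h3
      have h7 : Real.exp ν * Real.exp (-ν) = 1 := by rw [← Real.exp_add]; simp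
      have h8 := Real.exp_pos ν
      have h9 := Real.exp_pos (-ν)
      nlinarith [sq_nonneg (Real.exp ν - 1)]
    · have := Real.exp_le_exp.2 h4
      linarith
  have hH := isSelfAdjoint_hamiltonian v
  set ψ := resolventOp (hamiltonian v) z (delta y) with hψ
  have hψ' := sub_smul_id_resolventOp hH hz (delta y)
  rw [← hψ] at hψ'
  have huy : w y = 1 := by
    simp [w, u, latticeDist_self, latticeDist_nonneg]
  have h1 := abs_im_mul_norm_le hH z (potentialOp w ψ)
  rw [hamiltonian_sub_smul_potentialOp, hψ', potentialOp_delta hw huy] at h1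
  have h2 : ‖∑ i : Fin d, ((potentialOp w (shift (Pi.single i 1) ψ)
            - shift (Pi.single i 1) (potentialOp w ψ))
          + (potentialOp w (shift (-Pi.single i 1) ψ)
            - shift (-Pi.single i 1) (potentialOp w ψ)))‖
      ≤ 2 * d * (Real.exp ν - 1) * ‖potentialOp w ψ‖ := by
    refine (norm_sum_le_of_le (f := fun i : Fin d =>
      ((potentialOp w (shift (Pi.single i 1) ψ)
            - shift (Pi.single i 1) (potentialOp w ψ))
          + (potentialOp w (shift (-Pi.single i 1) ψ)
            - shift (-Pi.single i 1) (potentialOp w ψ)))) Finset.univ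
      (n := fun _ => 2 * ((Real.exp ν - 1) * ‖potentialOp w ψ‖)) fun i _ => ?_).trans
      (le_of_eq ?_)
    · rw [two_mul]
      refine norm_add_le_of_le (norm_commutator_shift_le hw hκ _ (hwa _ fun x' => ?_) ψ)
        (norm_commutator_shift_le hw hκ _ (hwa _ fun x' => ?_) ψ)
      · rw [latticeDist_add_single]
        simp
      · rw [← Pi.single_neg, latticeDist_add_single]
        simp
    · simp
      ring
  have h3 := h1.trans (norm_add_le _ _)
  rw [norm_delta] at h3
  have hz0 : 0 < |z.im| := abs_pos.2 hz
  -- By the choice of `ν` the commutators cost at most half of `|Im z| ‖wψ‖`, which moves to the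
  -- left side.
  have h4 : ‖potentialOp w ψ‖ ≤ 2 / |z.im| := by
    rw [le_div_iff₀ hz0]
    nlinarith [norm_nonneg (potentialOp w ψ)]
  have h5 : ‖(potentialOp w ψ : Site d → ℂ) x‖ ≤ ‖potentialOp w ψ‖ :=
    lp.norm_apply_le_norm (by norm_num) _ x
  have hux : u x = latticeDist x y := min_self _
  rw [potentialOp_apply hw, norm_mul, Complex.norm_real, Real.norm_eq_abs,
    abs_of_pos (Real.exp_pos _), hux] at h5
  rw [green_eq, inner_delta, ← hψ, neg_mul, Real.exp_neg, ← div_eq_mul_inv,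
    le_div_iff₀ (Real.exp_pos _)]
  linarith

theorem norm_green_conj (v : Site d → ℝ) (x y : Site d) {z : ℂ} (hz : z.im ≠ 0) :
    ‖green v x y (starRingEnd ℂ z)‖ = ‖green v y x z‖ :=
  norm_inner_resolventOp_conj (isSelfAdjoint_hamiltonian v) hz _ _

/-! ### Measurability of the Green function -/

section Measurability

open Classical in
theorem potentialOp_truncate_eq_sum {v : Site d → ℝ} (hv : ∃ C, ∀ x, |v x| ≤ C)
    (Λ : Finset (Site d)) (ψ : L2 d) :
    (∑ u ∈ Λ, (v u : ℂ) • potentialOp (Pi.single u 1)) ψ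
      = ∑ u ∈ Λ, lp.single 2 u ((potentialOp v ψ : Site d → ℂ) u) := by
  rw [sum_apply]
  refine Finset.sum_congr rfl fun u _ => ?_
  have hu : ∃ C, ∀ x, |(Pi.single u 1 : Site d → ℝ) x| ≤ C := by
    refine ⟨1, fun x => ?_⟩
    by_cases h : x = u
    · subst h; simp
    · simp [Pi.single_eq_of_ne h]
  ext x
  rw [smul_apply, lp.coeFn_smul, Pi.smul_apply, potentialOp_apply hu, potentialOp_apply hv,
    lp.coeFn_single]
  by_cases h : x = u
  · subst h; simp
  · simp [Pi.single_eq_of_ne h]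

-- Cutting the potential off to a finite set converges strongly, not in norm. This is enough,
-- because the resolvent identity applies the error to the fixed vector `ψ = (H - z)⁻¹ δ_y`.
open Classical in
theorem tendsto_inner_resolventOp_truncate {v : Site d → ℝ} (hv : ∃ C, ∀ x, |v x| ≤ C)
    (x y : Site d) {z : ℂ} (hz : z.im ≠ 0) :
    Tendsto (fun Λ : Finset (Site d) => inner ℂ (delta x) (resolventOp
      (-laplacian d + ∑ u ∈ Λ, (v u : ℂ) • potentialOp (Pi.single u 1)) z (delta y))) atTop
      (𝓝 (green v x y z)) := by
  rw [green_eq]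
  refine Tendsto.inner tendsto_const_nhds ?_
  set ψ := resolventOp (hamiltonian v) z (delta y) with hψ
  have hψ' := sub_smul_id_resolventOp (isSelfAdjoint_hamiltonian v) hz (delta y)
  rw [← hψ] at hψ'
  rw [tendsto_iff_norm_sub_tendsto_zero]
  have hsum := lp.hasSum_single (E := fun _ : Site d => ℂ) (p := 2) (by norm_num)
    (potentialOp v ψ)
  have hlim : Tendsto (fun Λ : Finset (Site d) =>
      ‖(∑ u ∈ Λ, (v u : ℂ) • potentialOp (Pi.single u 1)) ψ - potentialOp v ψ‖ / |z.im|)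
      atTop (𝓝 0) := by
    simp_rw [potentialOp_truncate_eq_sum hv]
    have := (tendsto_iff_norm_sub_tendsto_zero.1 hsum).div_const |z.im|
    simpa using this
  refine squeeze_zero (fun _ => norm_nonneg _) (fun Λ => ?_) hlim
  set B := ∑ u ∈ Λ, (v u : ℂ) • potentialOp (Pi.single u (1 : ℝ)) with hB
  have hBs : IsSelfAdjoint (-laplacian d + B) := by
    refine (isSelfAdjoint_laplacian d).neg.add (isSelfAdjoint_sum _ fun u _ => ?_)
    exact IsSelfAdjoint.smul (Complex.conj_ofReal _) (isSelfAdjoint_potentialOp _)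
  have e : resolventOp (-laplacian d + B) z (delta y) - ψ
      = resolventOp (-laplacian d + B) z (potentialOp v ψ - B ψ) := by
    have h1 := resolventOp_sub_smul_id hBs hz ψ
    rw [← hψ']
    nth_rewrite 2 [← h1]
    rw [← map_sub]
    congr 1
    simp [hamiltonian]
  rw [e, norm_sub_rev (B ψ)]
  exact norm_resolventOp_apply_le hBs hz _

-- Each cut-off Green function is continuous in the site values, since inversion is continuous at
-- units; the Green function is their pointwise limit.
open Classical in
theorem measurable_green {Ω : Type*} [MeasurableSpace Ω] {V : Site d → Ω → ℝ}
    (hV : ∀ x, Measurable (V x)) (hb : ∀ ω, ∃ C, ∀ x, |V x ω| ≤ C) (x y : Site d) {z : ℂ}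
    (hz : z.im ≠ 0) : Measurable fun ω => green (fun u => V u ω) x y z := by
  refine measurable_of_tendsto_metrizable' (u := (atTop : Filter (Finset (Site d))))
    (f := fun Λ ω => inner ℂ (delta x) (resolventOp
      (-laplacian d + ∑ u ∈ Λ, (V u ω : ℂ) • potentialOp (Pi.single u 1)) z (delta y)))
    (fun Λ => ?_) (tendsto_pi_nhds.2 fun ω => tendsto_inner_resolventOp_truncate (hb ω) x y hz)
  have hc : Continuous fun c : Site d → ℝ => inner ℂ (delta x) (resolventOp
      (-laplacian d + ∑ u ∈ Λ, (c u : ℂ) • potentialOp (Pi.single u 1)) z (delta y)) := by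
    refine Continuous.inner continuous_const (Continuous.clm_apply ?_ continuous_const)
    refine continuous_iff_continuousAt.2 fun c => ?_
    have hBs : IsSelfAdjoint (-laplacian d + ∑ u ∈ Λ, (c u : ℂ) • potentialOp (Pi.single u 1)) := by
      refine (isSelfAdjoint_laplacian d).neg.add (isSelfAdjoint_sum _ fun u _ => ?_)
      exact IsSelfAdjoint.smul (Complex.conj_ofReal _) (isSelfAdjoint_potentialOp _)
    obtain ⟨U, hU⟩ := isUnit_sub_smul_id hBs hz
    have h1 := NormedRing.inverse_continuousAt U
    rw [hU] at h1
    refine ContinuousAt.comp (f := fun c : Site d → ℝ => -laplacian d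
      + ∑ u ∈ Λ, (c u : ℂ) • potentialOp (Pi.single u 1) - z • ContinuousLinearMap.id ℂ (L2 d))
      h1 (Continuous.continuousAt ?_)
    exact (continuous_const.add (continuous_finsetSum _ fun u _ =>
      (Complex.continuous_ofReal.comp (continuous_apply u)).smul continuous_const)).sub
        continuous_const
  exact hc.measurable.comp (measurable_pi_lambda _ hV)

end Measurability

end Lattice

/-! ### Upper limits under the integral -/

theorem limsup_add_const_ennreal (u : ℕ → ℝ≥0∞) (c : ℝ≥0∞) :
    limsup (fun n => u n + c) atTop = limsup u atTop + c :=
  (Monotone.map_limsup_of_continuousAt (f := fun t : ℝ≥0∞ => t + c)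
    (fun _ _ h => add_le_add_left h c) u (continuous_add_const c).continuousAt).symm

/-- Reverse Fatou lemma for a uniformly integrable sequence. -/
theorem limsup_setLIntegral_le {α : Type*} [MeasurableSpace α] {ν : Measure α}
    [IsProbabilityMeasure ν] {S : Set α} {m : ℕ → α → ℝ≥0∞}
    (hm : ∀ n, Measurable (m n)) {B : ℝ≥0∞} (hB : ∀ a ∈ S, limsup (fun n => m n a) atTop ≤ B)
    {K δ : ℕ → ℝ≥0∞} (hK : ∀ k, K k ≠ ∞) (hδ : Tendsto δ atTop (𝓝 0))
    (hint : ∀ k n, ∫⁻ a in S, m n a ∂ν ≤ (∫⁻ a in S, min (m n a) (K k) ∂ν) + δ k) :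
    limsup (fun n => ∫⁻ a in S, m n a ∂ν) atTop ≤ B := by
  have key : ∀ k, limsup (fun n => ∫⁻ a in S, m n a ∂ν) atTop ≤ B + δ k := by
    intro k
    -- The truncated functions have the integrable majorant `K k`, so the ordinary reverse Fatou
    -- lemma applies; the error `δ k` does not depend on `n`.
    have h1 : limsup (fun n => ∫⁻ a in S, min (m n a) (K k) ∂ν) atTop ≤ B := by
      refine (limsup_lintegral_le (fun _ => K k) (fun n => (hm n).min measurable_const)
        (fun n => ae_of_all _ fun a => min_le_right _ _) ?_).trans ?_
      · rw [lintegral_const]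
        exact ENNReal.mul_ne_top (hK k) (measure_ne_top _ _)
      · calc ∫⁻ a in S, limsup (fun n => min (m n a) (K k)) atTop ∂ν ≤ ∫⁻ a in S, B ∂ν := by
              refine setLIntegral_mono measurable_const fun a ha => le_trans ?_ (hB a ha)
              exact limsup_le_limsup (Eventually.of_forall fun n => min_le_left _ _)
          _ ≤ B := by
              rw [lintegral_const]
              exact mul_le_of_le_one_right' ((Measure.restrict_apply_le _ _).trans prob_le_one)
    calc limsup (fun n => ∫⁻ a in S, m n a ∂ν) atTop
        ≤ limsup (fun n => (∫⁻ a in S, min (m n a) (K k) ∂ν) + δ k) atTop :=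
          limsup_le_limsup (Eventually.of_forall fun n => hint k n)
      _ ≤ B + δ k := by
          rw [limsup_add_const_ennreal]
          gcongr
  have h2 : Tendsto (fun k => B + δ k) atTop (𝓝 (B + 0)) := tendsto_const_nhds.add hδ
  rw [add_zero] at h2
  exact ge_of_tendsto' h2 key

theorem ofReal_rpow_le_min_add {t τ s s' : ℝ} (ht : 0 ≤ t) (hτ : 0 < τ) (hs : 0 < s) (hss : s < s') :
    ENNReal.ofReal (t ^ s) ≤ min (ENNReal.ofReal (t ^ s)) (ENNReal.ofReal (τ ^ s))
      + ENNReal.ofReal (τ ^ (s - s')) * ENNReal.ofReal (t ^ s') := by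
  rcases le_or_gt t τ with h | h
  · rw [min_eq_left (ENNReal.ofReal_le_ofReal (Real.rpow_le_rpow ht h hs.le))]
    exact le_self_add
  · refine le_add_left ?_
    rw [← ENNReal.ofReal_mul (by positivity)]
    refine ENNReal.ofReal_le_ofReal ?_
    have ht0 : 0 < t := hτ.trans h
    calc t ^ s = t ^ (s - s') * t ^ s' := by rw [← Real.rpow_add ht0]; ring_nf
      _ ≤ τ ^ (s - s') * t ^ s' := by
        gcongr ?_ * _
        exact Real.rpow_le_rpow_of_nonpos hτ h.le (by linarith)

/-! ### Fractional moments averaged over the energy -/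

section Moments

variable {d : ℕ} {Ω : Type*} [MeasurableSpace Ω] {P : Measure Ω}
  {V : Site d → Ω → ℝ}

theorem greenMoment_add_eq (s : ℝ) (x y : Site d) (E ξ ε : ℝ) :
    greenMoment P V s x y (E + ξ) ε = ∫⁻ ω, ENNReal.ofReal (‖inner ℂ (delta x)
      (resolventOp (hamiltonian fun u => V u ω) (E + ξ + ε * Complex.I) (delta y))‖ ^ s) ∂P := by
  simp only [greenMoment, green_eq, Complex.ofReal_add]

theorem measurable_uncurry_green (hV : ∀ x, Measurable (V x))
    (hb : ∀ ω, ∃ C, ∀ x, |V x ω| ≤ C) (x y : Site d) (E : ℝ) {s ε : ℝ} (hs : 0 < s) (hε : 0 < ε) :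
    Measurable (Function.uncurry fun (ξ : ℝ) (ω : Ω) => ENNReal.ofReal (‖inner ℂ (delta x)
      (resolventOp (hamiltonian fun u => V u ω) (E + ξ + ε * Complex.I) (delta y))‖ ^ s)) := by
  refine measurable_uncurry_of_continuous_of_measurable (fun ω => ?_) fun ξ => ?_
  · refine ENNReal.continuous_ofReal.comp (continuous_comp_ofReal (q := fun z => ‖inner ℂ (delta x)
      (resolventOp (hamiltonian fun u => V u ω) (E + z + ε * Complex.I) (delta y))‖ ^ s) hε ?_)
    exact (differentiableOn_inner_resolventOp_shift (isSelfAdjoint_hamiltonian _) E ε _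
      _).continuousOn.norm.rpow_const fun _ _ => Or.inr hs.le
  · have := measurable_green hV hb x y (z := E + ξ + ε * Complex.I) (by simpa using hε.ne')
    simp only [green_eq] at this
    exact (this.norm.pow_const s).ennreal_ofReal

theorem measurable_greenMoment_add [IsProbabilityMeasure P]
    (hV : ∀ x, Measurable (V x))
    (hb : ∀ ω, ∃ C, ∀ x, |V x ω| ≤ C) (x y : Site d) (E : ℝ) {s ε : ℝ} (hs : 0 < s) (hε : 0 < ε) :
    Measurable fun ξ : ℝ => greenMoment P V s x y (E + ξ) ε := by
  simp only [greenMoment_add_eq]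
  exact (measurable_uncurry_green hV hb x y E hs hε).lintegral_prod_right'

theorem lintegral_greenMoment_add_eq [IsProbabilityMeasure P] (hV : ∀ x, Measurable (V x))
    (hb : ∀ ω, ∃ C, ∀ x, |V x ω| ≤ C) (x y : Site d) (E : ℝ) {s ε : ℝ} (hs : 0 < s) (hε : 0 < ε)
    (ν : Measure ℝ) [SFinite ν] :
    ∫⁻ ξ : ℝ, greenMoment P V s x y (E + ξ) ε ∂ν
      = ∫⁻ ω, ∫⁻ ξ : ℝ, ENNReal.ofReal (‖inner ℂ (delta x) (resolventOp
        (hamiltonian fun u => V u ω) (E + ξ + ε * Complex.I) (delta y))‖ ^ s) ∂ν ∂P := by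
  simp only [greenMoment_add_eq]
  exact lintegral_lintegral_swap (measurable_uncurry_green hV hb x y E hs hε).aemeasurable

theorem lintegral_poisson_greenMoment_le [IsProbabilityMeasure P]
    (hV : ∀ x, Measurable (V x))
    (hb : ∀ ω, ∃ C, ∀ x, |V x ω| ≤ C) (x y : Site d) (E : ℝ) {s ε η : ℝ} (hs : 0 < s) (hs1 : s < 1)
    (hε : 0 < ε) (hη : 0 < η) :
    ∫⁻ ξ : ℝ, greenMoment P V s x y (E + ξ) ε ∂(poissonMeasure η)
      ≤ 4 * ENNReal.ofReal ((4 / η + 1) ^ s / Real.cos (Real.pi * s / 2)) := by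
  have := isProbabilityMeasure_poissonMeasure hη
  rw [lintegral_greenMoment_add_eq hV hb x y E hs hε]
  refine (lintegral_mono fun ω => lintegral_poisson_resolventOp_le
    (isSelfAdjoint_hamiltonian fun u => V u ω) hε hη hs hs1 (norm_delta x).le
      (norm_delta y).le).trans ?_
  rw [lintegral_const, measure_univ, mul_one]

theorem greenMoment_mul_exp_le_lintegral [IsProbabilityMeasure P]
    (hV : ∀ x, Measurable (V x))
    (hb : ∀ ω, ∃ C, ∀ x, |V x ω| ≤ C) (x y : Site d) (E : ℝ) {s ε η ρ a : ℝ} (hs : 0 < s)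
    (hs1 : s < 1) (hε : 0 < ε) (hη : 0 < η) (hηρ : η ≤ ρ / 2) (ha : 0 ≤ a) :
    greenMoment P V s x y E (η + ε) * ENNReal.ofReal (Real.exp (a / 3))
      ≤ ENNReal.ofReal (Real.exp a) * ∫⁻ ξ in {ξ : ℝ | |ξ| < ρ},
          greenMoment P V s x y (E + ξ) ε ∂(poissonMeasure η)
        + 4 * ENNReal.ofReal ((4 / ρ + 1) ^ s / Real.cos (Real.pi * s / 2)) := by
  have hρ : 0 < ρ := by linarith
  have := isProbabilityMeasure_poissonMeasure hη
  have := isProbabilityMeasure_poissonMeasure hρ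
  have hm := (measurable_uncurry_green hV hb x y E hs hε).lintegral_prod_left (μ := poissonMeasure ρ)
  have hout := lintegral_poisson_greenMoment_le (P := P) hV hb x y E hs hs1 hε hρ
  have hpt : ∀ ω, ENNReal.ofReal (‖green (fun u => V u ω) x y
      ((E : ℂ) + ((η + ε : ℝ) : ℂ) * Complex.I)‖ ^ s) * ENNReal.ofReal (Real.exp (a / 3))
      ≤ ENNReal.ofReal (Real.exp a) * ∫⁻ ξ in {ξ : ℝ | |ξ| < ρ}, ENNReal.ofReal (‖inner ℂ (delta x)
        (resolventOp (hamiltonian fun u => V u ω) (E + ξ + ε * Complex.I) (delta y))‖ ^ s)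
          ∂(poissonMeasure η)
        + ∫⁻ ξ : ℝ, ENNReal.ofReal (‖inner ℂ (delta x)
        (resolventOp (hamiltonian fun u => V u ω) (E + ξ + ε * Complex.I) (delta y))‖ ^ s)
          ∂(poissonMeasure ρ) := by
    intro ω
    have hH := isSelfAdjoint_hamiltonian fun u => V u ω
    have h := norm_rpow_mul_exp_le_lintegral_poisson hη hηρ hε hs ha
      (differentiableOn_inner_resolventOp_shift hH E ε (delta x) (delta y))
      (fun z hz => norm_inner_resolventOp_shift_le hH hε (delta x) (delta y) (by linarith))
    have e : (E : ℂ) + ((η + ε : ℝ) : ℂ) * Complex.I = E + η * Complex.I + ε * Complex.I := by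
      push_cast
      ring
    rw [green_eq, e]
    exact h
  calc greenMoment P V s x y E (η + ε) * ENNReal.ofReal (Real.exp (a / 3))
      = ∫⁻ ω, ENNReal.ofReal (‖green (fun u => V u ω) x y
          ((E : ℂ) + ((η + ε : ℝ) : ℂ) * Complex.I)‖ ^ s) * ENNReal.ofReal (Real.exp (a / 3)) ∂P :=
        (lintegral_mul_const' _ _ ENNReal.ofReal_ne_top).symm
    _ ≤ _ := lintegral_mono hpt
    _ = ENNReal.ofReal (Real.exp a) * (∫⁻ ξ in {ξ : ℝ | |ξ| < ρ},
          greenMoment P V s x y (E + ξ) ε ∂(poissonMeasure η))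
        + ∫⁻ ξ, greenMoment P V s x y (E + ξ) ε ∂(poissonMeasure ρ) := by
        rw [lintegral_add_right _ hm,
          lintegral_const_mul' _ _ ENNReal.ofReal_ne_top,
          lintegral_greenMoment_add_eq hV hb x y E hs hε,
          lintegral_greenMoment_add_eq hV hb x y E hs hε]
    _ ≤ _ := by gcongr

/-- This is uniform integrability in `ε`: the excess above the level `τ ^ s` is paid for by the
moment of the higher exponent `s'`, whose Poisson average is bounded independently of `ε`, with a
factor `τ ^ (s - s')` that vanishes as `τ → ∞`. -/
theorem setLIntegral_greenMoment_le_min_add [IsProbabilityMeasure P]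
    (hV : ∀ x, Measurable (V x))
    (hb : ∀ ω, ∃ C, ∀ x, |V x ω| ≤ C) (x y : Site d) (E : ℝ) {s s' ε η τ : ℝ} (hs : 0 < s)
    (hss : s < s') (hs1 : s' < 1) (hε : 0 < ε) (hη : 0 < η) (hτ : 0 < τ) (S : Set ℝ) :
    ∫⁻ ξ in S, greenMoment P V s x y (E + ξ) ε ∂(poissonMeasure η)
      ≤ (∫⁻ ξ in S, min (greenMoment P V s x y (E + ξ) ε) (ENNReal.ofReal (τ ^ s))
          ∂(poissonMeasure η)) + ENNReal.ofReal (τ ^ (s - s'))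
        * (4 * ENNReal.ofReal ((4 / η + 1) ^ s' / Real.cos (Real.pi * s' / 2))) := by
  have hs' : 0 < s' := hs.trans hss
  have hout := lintegral_poisson_greenMoment_le (P := P) hV hb x y E hs' hs1 hε hη
  have hmeas := measurable_greenMoment_add (P := P) hV hb x y E hs' hε
  have hpt : ∀ ξ : ℝ, greenMoment P V s x y (E + ξ) ε
      ≤ min (greenMoment P V s x y (E + ξ) ε) (ENNReal.ofReal (τ ^ s))
        + ENNReal.ofReal (τ ^ (s - s')) * greenMoment P V s' x y (E + ξ) ε := by
    intro ξ
    have hm : Measurable fun ω => ENNReal.ofReal (‖inner ℂ (delta x)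
        (resolventOp (hamiltonian fun u => V u ω) (E + ξ + ε * Complex.I) (delta y))‖ ^ s') :=
      (measurable_uncurry_green hV hb x y E hs' hε).of_uncurry_left
    simp only [greenMoment_add_eq]
    refine (lintegral_mono fun ω => ofReal_rpow_le_min_add (norm_nonneg _) hτ hs hss).trans ?_
    rw [lintegral_add_right _ (hm.const_mul _), lintegral_const_mul _ hm]
    refine add_le_add (le_min (lintegral_mono fun ω => min_le_left _ _) ?_) le_rfl
    refine (lintegral_mono fun ω => min_le_right _ _).trans ?_
    rw [lintegral_const, measure_univ, mul_one]
  calc _ ≤ ∫⁻ ξ in S, (min (greenMoment P V s x y (E + ξ) ε) (ENNReal.ofReal (τ ^ s))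
        + ENNReal.ofReal (τ ^ (s - s')) * greenMoment P V s' x y (E + ξ) ε) ∂(poissonMeasure η) :=
        lintegral_mono hpt
    _ = (∫⁻ ξ in S, min (greenMoment P V s x y (E + ξ) ε) (ENNReal.ofReal (τ ^ s))
          ∂(poissonMeasure η)) + ENNReal.ofReal (τ ^ (s - s'))
          * ∫⁻ ξ in S, greenMoment P V s' x y (E + ξ) ε ∂(poissonMeasure η) := by
        rw [lintegral_add_right _ (hmeas.const_mul _), lintegral_const_mul _ hmeas]
    _ ≤ _ := by
        gcongr
        exact (setLIntegral_le_lintegral S _).trans hout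

theorem limsup_comp_le_greenMomentPlus (s : ℝ) (x y : Site d) (E : ℝ) :
    limsup (fun n : ℕ => greenMoment P V s x y E (1 / ((n : ℝ) + 1))) atTop
      ≤ greenMomentPlus P V s x y E := by
  have ht : Tendsto (fun n : ℕ => 1 / ((n : ℝ) + 1)) atTop (𝓝[>] 0) :=
    tendsto_nhdsWithin_iff.2 ⟨tendsto_one_div_add_atTop_nhds_zero_nat,
      Eventually.of_forall fun n => by
        simp only [Set.mem_Ioi]
        positivity⟩
  exact limsup_le_limsup_of_le (u := fun η => greenMoment P V s x y E η)
    (f := map (fun n : ℕ => 1 / ((n : ℝ) + 1)) atTop) ht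

/-- Fatou's lemma in `ω`, with continuity of the Green function at non-real energies. It removes the
upward shift of the evaluation point by `ε`. -/
theorem greenMoment_le_liminf (hV : ∀ x, Measurable (V x))
    (hb : ∀ ω, ∃ C, ∀ x, |V x ω| ≤ C) (x y : Site d) (E : ℝ) {s η : ℝ} (hs : 0 < s) (hη : 0 < η) :
    greenMoment P V s x y E η
      ≤ liminf (fun n : ℕ => greenMoment P V s x y E (η + 1 / ((n : ℝ) + 1))) atTop := by
  have hpt : ∀ ω, liminf (fun n : ℕ => ENNReal.ofReal (‖green (fun u => V u ω) x y
      ((E : ℂ) + ((η + 1 / ((n : ℝ) + 1) : ℝ) : ℂ) * Complex.I)‖ ^ s)) atTop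
      = ENNReal.ofReal (‖green (fun u => V u ω) x y ((E : ℂ) + (η : ℂ) * Complex.I)‖ ^ s) := by
    intro ω
    refine Tendsto.liminf_eq (ENNReal.tendsto_ofReal ?_)
    refine Tendsto.rpow_const (Tendsto.norm ?_) (Or.inr hs.le)
    have h1 : ContinuousAt (fun z => green (fun u => V u ω) x y z)
        ((E : ℂ) + (η : ℂ) * Complex.I) := by
      simp only [green_eq]
      exact (differentiableAt_inner_resolventOp (isSelfAdjoint_hamiltonian _)
        (by simpa using hη.ne') _ _).continuousAt
    refine h1.tendsto.comp (tendsto_const_nhds.add (Tendsto.mul_const _ ?_))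
    have h2 : Tendsto (fun n : ℕ => η + 1 / ((n : ℝ) + 1)) atTop (𝓝 (η + 0)) :=
      tendsto_const_nhds.add tendsto_one_div_add_atTop_nhds_zero_nat
    rw [add_zero] at h2
    exact (Complex.continuous_ofReal.tendsto η).comp h2
  have := lintegral_liminf_le (μ := P) (u := atTop) (f := fun (n : ℕ) ω =>
    ENNReal.ofReal (‖green (fun u => V u ω) x y
      ((E : ℂ) + ((η + 1 / ((n : ℝ) + 1) : ℝ) : ℂ) * Complex.I)‖ ^ s)) fun n =>
    ((measurable_green hV hb x y (by
      have : 0 < η + 1 / ((n : ℝ) + 1) := by positivity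
      rw [Complex.add_im, Complex.ofReal_im, Complex.im_ofReal_mul, Complex.I_im, mul_one, zero_add]
      exact this.ne')).norm.pow_const s).ennreal_ofReal
  simp only [hpt] at this
  exact this

theorem greenMoment_mul_exp_le [IsProbabilityMeasure P]
    (hV : ∀ x, Measurable (V x))
    (hb : ∀ ω, ∃ C, ∀ x, |V x ω| ≤ C) (x y : Site d) (E : ℝ) {s η ρ a : ℝ} (hs : 0 < s)
    (hs1 : s < 1) (hη : 0 < η) (hηρ : η ≤ ρ / 2) (ha : 0 ≤ a) {B : ℝ≥0∞}
    (hB : ∀ ξ ∈ Set.Icc (E - ρ) (E + ρ), greenMomentPlus P V s x y ξ ≤ B) :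
    greenMoment P V s x y E η * ENNReal.ofReal (Real.exp (a / 3))
      ≤ ENNReal.ofReal (Real.exp a) * B
        + 4 * ENNReal.ofReal ((4 / ρ + 1) ^ s / Real.cos (Real.pi * s / 2)) := by
  have := isProbabilityMeasure_poissonMeasure hη
  have hε : ∀ n : ℕ, 0 < 1 / ((n : ℝ) + 1) := fun n => by positivity
  -- Any exponent strictly between `s` and `1` would do.
  set s' := (1 + s) / 2 with hs'
  have hss : s < s' := by linarith
  have hs1' : s' < 1 := by linarith
  have hlim : limsup (fun n : ℕ => ∫⁻ ξ in {ξ : ℝ | |ξ| < ρ},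
      greenMoment P V s x y (E + ξ) (1 / ((n : ℝ) + 1)) ∂(poissonMeasure η)) atTop ≤ B := by
    refine limsup_setLIntegral_le
      (fun n => measurable_greenMoment_add hV hb x y E hs (hε n)) (fun ξ hξ => ?_)
      (K := fun k => ENNReal.ofReal (((k : ℝ) + 1) ^ s)) (fun k => ENNReal.ofReal_ne_top) ?_
      (fun k n => setLIntegral_greenMoment_le_min_add hV hb x y E hs hss hs1' (hε n) hη
        (τ := (k : ℝ) + 1) (by positivity) _)
    · have h1 := abs_lt.1 (show |ξ| < ρ from hξ)
      exact (limsup_comp_le_greenMomentPlus s x y (E + ξ)).trans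
        (hB _ ⟨by linarith, by linarith⟩)
    · have h1 : Tendsto (fun k : ℕ => ((k : ℝ) + 1) ^ (s - s')) atTop (𝓝 0) := by
        rw [← neg_sub s' s]
        exact (tendsto_rpow_neg_atTop (by linarith)).comp
          (tendsto_atTop_add_const_right _ _ tendsto_natCast_atTop_atTop)
      have h2 := ENNReal.Tendsto.mul_const (ENNReal.tendsto_ofReal h1)
        (b := 4 * ENNReal.ofReal ((4 / η + 1) ^ s' / Real.cos (Real.pi * s' / 2)))
        (Or.inr (ENNReal.mul_ne_top (by norm_num) ENNReal.ofReal_ne_top))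
      simpa using h2
  set c := ENNReal.ofReal (Real.exp (a / 3))
  set D := 4 * ENNReal.ofReal ((4 / ρ + 1) ^ s / Real.cos (Real.pi * s / 2))
  calc greenMoment P V s x y E η * c
      ≤ liminf (fun n : ℕ => greenMoment P V s x y E (η + 1 / ((n : ℝ) + 1))) atTop * c :=
        mul_le_mul_left (greenMoment_le_liminf hV hb x y E hs hη) _
    _ ≤ limsup (fun n : ℕ => greenMoment P V s x y E (η + 1 / ((n : ℝ) + 1))) atTop * c :=
        mul_le_mul_left liminf_le_limsup _
    _ = limsup (fun n : ℕ => c * greenMoment P V s x y E (η + 1 / ((n : ℝ) + 1))) atTop := by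
        rw [ENNReal.limsup_const_mul_of_ne_top ENNReal.ofReal_ne_top, mul_comm]
    _ ≤ limsup (fun n : ℕ => ENNReal.ofReal (Real.exp a) * (∫⁻ ξ in {ξ : ℝ | |ξ| < ρ},
          greenMoment P V s x y (E + ξ) (1 / ((n : ℝ) + 1)) ∂(poissonMeasure η)) + D) atTop := by
        refine limsup_le_limsup (Eventually.of_forall fun n => ?_)
        simp only [mul_comm c]
        exact greenMoment_mul_exp_le_lintegral hV hb x y E hs hs1 (hε n) hη hηρ ha
    _ ≤ _ := by
        rw [limsup_add_const_ennreal, ENNReal.limsup_const_mul_of_ne_top ENNReal.ofReal_ne_top]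
        gcongr

end Moments

/-! ### The regimes of small, large and negative imaginary part -/

section Localization

variable {d : ℕ} {Ω : Type*} [MeasurableSpace Ω] {P : Measure Ω} {V : Site d → Ω → ℝ}

theorem greenMoment_congr_ae {V' : Site d → Ω → ℝ} (h : ∀ᵐ ω ∂P, ∀ x, V x ω = V' x ω) :
    greenMoment P V = greenMoment P V' := by
  funext s x y E η
  refine lintegral_congr_ae ?_
  filter_upwards [h] with ω hω
  simp only [hω]

/-- A regular potential is almost surely bounded, hence has a bounded modification. -/
theorem IsRegularPotential.exists_bounded_modification (h : IsRegularPotential P V) :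
    ∃ V' : Site d → Ω → ℝ, (∀ x, Measurable (V' x)) ∧ (∀ ω, ∃ C, ∀ x, |V' x ω| ≤ C) ∧
      ∀ᵐ ω ∂P, ∀ x, V x ω = V' x ω := by
  obtain ⟨ρ, hρm, -, hρc, hρ⟩ := h.density
  obtain ⟨R, hR0, hR⟩ := hρc.isCompact.isBounded.exists_pos_norm_le
  -- Clamping to an interval containing the support of the density changes each site value only on a
  -- null set, and there are countably many sites.
  refine ⟨fun x ω => max (-R) (min R (V x ω)),
    fun x => measurable_const.max (measurable_const.min (h.measurable x)),
    fun ω => ⟨R, fun x => abs_le.2 ⟨le_max_left _ _, max_le (by linarith) (min_le_left _ _)⟩⟩,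
    ae_all_iff.2 fun x => ?_⟩
  have h1 : ∀ᵐ t ∂(P.map (V x)), |t| ≤ R := by
    rw [hρ x, ae_withDensity_iff (by fun_prop)]
    refine ae_of_all _ fun t ht => hR t (subset_tsupport _ ?_)
    simpa using ht
  filter_upwards [ae_of_ae_map (h.measurable x).aemeasurable h1] with ω hω
  obtain ⟨h2, h3⟩ := abs_le.1 hω
  rw [min_eq_right h3, max_eq_right h2]

theorem greenMoment_neg (s : ℝ) (x y : Site d) (E : ℝ) {η : ℝ} (hη : η ≠ 0) :
    greenMoment P V s x y E (-η) = greenMoment P V s y x E η := by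
  refine lintegral_congr fun ω => ?_
  rw [← norm_green_conj _ x y (z := (E : ℂ) + (η : ℂ) * Complex.I) (by simpa using hη)]
  simp

/-- Fractional moments decay exponentially away from the real axis. -/
theorem greenMoment_le_of_le [IsProbabilityMeasure P] {s : ℝ} (hs : 0 < s) (x y : Site d) (E : ℝ)
    {η δ ν : ℝ} (hδ : 0 < δ) (hη : δ ≤ η) (hν : 0 ≤ ν) (hνδ : 2 * d * (Real.exp ν - 1) ≤ δ / 2) :
    greenMoment P V s x y E η
      ≤ ENNReal.ofReal ((2 / δ) ^ s * Real.exp (-(ν * s) * latticeDist x y)) := by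
  have him : ((E : ℂ) + (η : ℂ) * Complex.I).im = η := by simp
  have hη0 : 0 < η := hδ.trans_le hη
  calc greenMoment P V s x y E η
      ≤ ∫⁻ _, ENNReal.ofReal ((2 / δ) ^ s * Real.exp (-(ν * s) * latticeDist x y)) ∂P := by
        refine lintegral_mono fun ω => ENNReal.ofReal_le_ofReal ?_
        have h1 := norm_green_le_exp (fun u => V u ω) x y
          (z := (E : ℂ) + (η : ℂ) * Complex.I) (by rw [him]; exact hη0.ne') hν
          (by rw [him, abs_of_pos hη0]; linarith)
        rw [him, abs_of_pos hη0] at h1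
        have h2 : 2 / η * Real.exp (-ν * latticeDist x y)
            ≤ 2 / δ * Real.exp (-ν * latticeDist x y) := by gcongr
        refine (Real.rpow_le_rpow (norm_nonneg _) (h1.trans h2) hs.le).trans (le_of_eq ?_)
        rw [Real.mul_rpow (by positivity) (by positivity), ← Real.exp_mul]
        ring_nf
    _ = _ := by rw [lintegral_const, measure_univ, mul_one]

/-- Fractional moments close to an energy interval of exponential decay on the real axis. -/
theorem greenMoment_le_of_greenMomentPlus_le [IsProbabilityMeasure P] (hV : ∀ x, Measurable (V x))
    (hb : ∀ ω, ∃ C, ∀ x, |V x ω| ≤ C) (x y : Site d) (E : ℝ) {s η ρ A μ : ℝ} (hs : 0 < s)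
    (hs1 : s < 1) (hη : 0 < η) (hηρ : η ≤ ρ / 2) (hμ : 0 < μ) (hA : 0 ≤ A)
    (hB : ∀ ξ ∈ Set.Icc (E - ρ) (E + ρ), greenMomentPlus P V s x y ξ
      ≤ ENNReal.ofReal (A * Real.exp (-μ * latticeDist x y))) :
    greenMoment P V s x y E η
      ≤ ENNReal.ofReal ((A + 4 * ((4 / ρ + 1) ^ s / Real.cos (Real.pi * s / 2)))
        * Real.exp (-(μ / 3) * latticeDist x y)) := by
  have hρ : 0 < ρ := by linarith
  have hcos : 0 < Real.cos (Real.pi * s / 2) := Real.cos_pos_of_mem_Ioo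
    ⟨by nlinarith [Real.pi_pos], by nlinarith [Real.pi_pos]⟩
  have hr := latticeDist_nonneg x y
  -- With `a = μ|x - y|` the factor `e^a` exactly cancels the assumed decay, leaving `e^{a/3}` as
  -- the gain.
  have h1 := greenMoment_mul_exp_le hV hb x y E hs hs1 hη hηρ
    (a := μ * latticeDist x y) (by positivity) hB
  rw [← ENNReal.ofReal_mul (by positivity), mul_left_comm, ← Real.exp_add, neg_mul,
    add_neg_cancel, Real.exp_zero, mul_one, ← ENNReal.ofReal_ofNat (4),
    ← ENNReal.ofReal_mul (by positivity), ← ENNReal.ofReal_add hA (by positivity)] at h1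
  rw [ENNReal.ofReal_mul (by positivity), neg_mul, Real.exp_neg,
    ENNReal.ofReal_inv_of_pos (by positivity), ← div_eq_mul_inv,
    ENNReal.le_div_iff_mul_le (Or.inl (by simp [Real.exp_pos])) (Or.inl ENNReal.ofReal_ne_top)]
  convert h1 using 4
  ring

end Localization

end RandomSchrodinger

end

/-! ### Choice of constants and conclusion -/

theorem theorem5 (d : ℕ) (s : ℝ) (hs0 : 0 < s) (hs1 : s < 1)
    (ΔE : ℝ) (hΔE : 0 < ΔE) (A μ : ℝ) (hμ : 0 < μ) :
    ∃ A' μ' : ℝ, 0 < μ' ∧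
      ∀ (Ω : Type*) [MeasurableSpace Ω] (P : Measure Ω) [IsProbabilityMeasure P]
        (V : RandomSchrodinger.Site d → Ω → ℝ),
        RandomSchrodinger.IsRegularPotential P V →
        ∀ E : ℝ,
          (∀ ξ ∈ Set.Icc (E - ΔE) (E + ΔE), ∀ x y : RandomSchrodinger.Site d,
            RandomSchrodinger.greenMomentPlus P V s x y ξ ≤
              ENNReal.ofReal (A * Real.exp (-μ * RandomSchrodinger.latticeDist x y))) →
          ∀ x y : RandomSchrodinger.Site d,
            (∀ η : ℝ, η ≠ 0 → RandomSchrodinger.greenMoment P V s x y E η ≤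
              ENNReal.ofReal (A' * Real.exp (-μ' * RandomSchrodinger.latticeDist x y))) ∧
            RandomSchrodinger.greenMomentPlus P V s x y E ≤
              ENNReal.ofReal (A' * Real.exp (-μ' * RandomSchrodinger.latticeDist x y)) ∧
            RandomSchrodinger.greenMomentMinus P V s x y E ≤
              ENNReal.ofReal (A' * Real.exp (-μ' * RandomSchrodinger.latticeDist x y)) := by
  have hcos : 0 < Real.cos (Real.pi * s / 2) := Real.cos_pos_of_mem_Ioo
    ⟨by nlinarith [Real.pi_pos], by nlinarith [Real.pi_pos]⟩
  -- This gives `2d(e^ν - 1) ≤ ΔE/4`, the Combes–Thomas condition at height `ΔE/2`; `d + 1` avoids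
  -- division by zero when `d = 0`.
  set ν := Real.log (1 + ΔE / (8 * (d + 1))) with hν
  have hν0 : 0 < ν := Real.log_pos (by simp; positivity)
  have hνΔ : 2 * d * (Real.exp ν - 1) ≤ ΔE / 2 / 2 := by
    rw [hν, Real.exp_log (by positivity), add_sub_cancel_left, mul_div_assoc',
      div_le_iff₀ (by positivity)]
    nlinarith
  -- `A` may be negative, while the estimate near the axis asks for a nonnegative constant.
  set C₁ := max A 0 + 4 * ((4 / ΔE + 1) ^ s / Real.cos (Real.pi * s / 2)) with hC₁
  set C₂ := (2 / (ΔE / 2)) ^ s with hC₂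
  have hC₁0 : 0 ≤ C₁ := by positivity
  have hC₂0 : 0 ≤ C₂ := by positivity
  refine ⟨C₁ + C₂, min (μ / 3) (ν * s), lt_min (by positivity) (by positivity), ?_⟩
  intro Ω _ P _ V hreg E hyp
  obtain ⟨V', hV'm, hV'b, hV'⟩ := hreg.exists_bounded_modification
  have hcongr := RandomSchrodinger.greenMoment_congr_ae hV'
  simp only [RandomSchrodinger.greenMomentPlus, RandomSchrodinger.greenMomentMinus, hcongr] at hyp ⊢
  have hpos : ∀ x y : RandomSchrodinger.Site d, ∀ η : ℝ, 0 < η →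
      RandomSchrodinger.greenMoment P V' s x y E η ≤ ENNReal.ofReal ((C₁ + C₂) *
        Real.exp (-min (μ / 3) (ν * s) * RandomSchrodinger.latticeDist x y)) := by
    intro x y η hη
    have hr := RandomSchrodinger.latticeDist_nonneg x y
    rcases le_total η (ΔE / 2) with h | h
    · refine (RandomSchrodinger.greenMoment_le_of_greenMomentPlus_le hV'm hV'b x y E hs0 hs1 hη h hμ
        (le_max_right A 0) fun ξ hξ => (hyp ξ hξ x y).trans ?_).trans ?_
      · gcongr
        exact le_max_left _ _
      · rw [← hC₁]
        gcongr
        · linarith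
        · exact min_le_left _ _
    · refine (RandomSchrodinger.greenMoment_le_of_le hs0 x y E (by positivity) h hν0.le hνΔ).trans ?_
      gcongr
      · linarith
      · exact min_le_right _ _
  have hneg : ∀ x y : RandomSchrodinger.Site d, ∀ η : ℝ, η < 0 →
      RandomSchrodinger.greenMoment P V' s x y E η ≤ ENNReal.ofReal ((C₁ + C₂) *
        Real.exp (-min (μ / 3) (ν * s) * RandomSchrodinger.latticeDist x y)) := by
    intro x y η hη
    -- Conjugating the energy swaps `x` and `y`, which is harmless because the bound is symmetric in
    -- them.
    have := RandomSchrodinger.greenMoment_neg (P := P) (V := V') s x y E (neg_ne_zero.2 hη.ne)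
    rw [neg_neg] at this
    rw [this, RandomSchrodinger.latticeDist_comm]
    exact hpos y x (-η) (neg_pos.2 hη)
  refine fun x y => ⟨fun η hη => ?_, ?_, ?_⟩
  · rcases lt_or_gt_of_ne hη with h | h
    · exact hneg x y η h
    · exact hpos x y η h
  · refine limsup_le_of_le (by isBoundedDefault) ?_
    filter_upwards [self_mem_nhdsWithin] with η hη
    exact hpos x y η hη
  · refine limsup_le_of_le (by isBoundedDefault) ?_
    filter_upwards [self_mem_nhdsWithin] with η hη
    exact hneg x y η hη
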